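/- **Theorem 2.** Let $f\colon \mathbb{R}^{m_1\times n_1}\times\dots\times\mathbb{R}^{m_L\times n_L}\to\mathbb{R}$ (the full fine-tuning loss) be twice differentiable and let $\lambda\ge 0$. For $\mathbf{X}=(X^{(1)},\dots,X^{(L)})$ write $\|\mathbf{X}\|_F=(\sum_l\|X^{(l)}\|_F^2)^{1/2}$, $\mathrm{rank}(\mathbf{X})=\max_l \mathrm{rank}(X^{(l)})$, $\|\mathbf{X}\|_*=\sum_l\|X^{(l)}\|_*$ (nuclear norms), and let $\nabla_l f$ and $\nabla^2_{l,l}f$ be the gradient and Hessian with respect to $X^{(l)}$. Let $$f^{\mathrm{full}}_\lambda(\mathbf{X})=f(\mathbf{X})+\lambda\|\mathbf{X}\|_*,\qquad f^{\mathrm{lora}}_\lambda(\mathbf{A},\mathbf{B})=f(\mathbf{A}\mathbf{B}^\intercal)+\tfrac{\lambda}{2}\big(\|\mathbf{A}\|_F^2+\|\mathbf{B}\|_F^2\big),$$ where $A^{(l)}\in\mathbb{R}^{m_l\times r}$, $B^{(l)}\in\mathbb{R}^{n_l\times r}$ and $\mathbf{A}\mathbf{B}^\intercal=(A^{(l)}(B^{(l)})^\intercal)_{l}$.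 Assume that $f^{\mathrm{full}}_\lambda$ has a global minimizer $\mathbf{X}_\star$ with $\mathrm{rank}(\mathbf{X}_\star)=r_\star\le r$. Let $D\in\mathbb{R}$, and let $\alpha^{(l)}>0$ and $\beta^{(l)}<\infty$ be real numbers such that for every $l$ and every $\mathbf{X}$ with $\|\mathbf{X}-\mathbf{X}_\star\|_F\le D$ and $\mathrm{rank}(\mathbf{X})\le r$: * (restricted strong convexity) $\langle\nabla_l f(\mathbf{X})-\nabla_l f(\mathbf{X}_\star),X^{(l)}-X_\star^{(l)}\rangle\ge\alpha^{(l)}\|X^{(l)}-X_\star^{(l)}\|_F^2$; * (restricted smoothness) $\nabla^2_{l,l}f(\mathbf{X})[W,W]\le\beta^{(l)}\|W\|_F^2$ for $W=UX^{(l)}+X^{(l)}V$ whenever $U\in\mathbb{R}^{m_l\times m_l}$ and $V\in\mathbb{R}^{n_l\times n_l}$ have rank one and Frobenius norm one (in particular one may take the largest such $\alpha^{(l)}$ and the smallest such $\beta^{(l)}$, when these are finite). Let $(\mathbf{A},\mathbf{B})$ be a second-order stationary point of $f^{\mathrm{lora}}_\lambda$ (zero gradient, positive semidefinite Hessian), and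 suppose $\mathbf{X}_\square=\mathbf{A}\mathbf{B}^\intercal$ satisfies $\|\mathbf{X}_\square-\mathbf{X}_\star\|_F\le D$. "Global minimum" below refers to $f^{\mathrm{full}}_\lambda$, $\sigma_k$ denotes the $k$-th largest singular value, and $\Pi_{\mathrm{rank}\le r_\star}$ denotes a projection in Frobenius norm onto the matrices of rank at most $r_\star$. 1. (Special regime) If $2\alpha^{(l)}\ge\beta^{(l)}$ for all $l$, with strict inequality for all $l$ in case $r=r_\star$, then $\mathbf{X}_\square$ is a global minimum. 2. (Generic regime) If $2\alpha^{(l)}<\beta^{(l)}$ for some $l$, or $r=r_\star$ and $2\alpha^{(l)}=\beta^{(l)}$ for some $l$, then one of the following holds. * (i) $\mathbf{X}_\square$ is a global minimum. * (ii) $\mathbf{X}_\square$ is not a global minimum, $r_\star\ge1$, and for some $l$ the matrix $X_\square^{(l)}$ has rank exactly $r$ and either $$\sigma_r(X_\square^{(l)})>\frac{2\alpha^{(l)}}{\beta^{(l)}}\,\sigma_{r_\star}(X_\square^{(l)})\quad\text{and}\quad \big\|X_\square^{(l)}-X_\star^{(l)}\big\|_F^2\ \ge\ \frac{\big\|X_\square^{(l)}-\Pi_{\mathrm{rank}\le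 r_\star}(X_\square^{(l)})\big\|_F^2}{1-\frac{2\alpha^{(l)}\sigma_{r_\star}(X_\square^{(l)})}{\beta^{(l)}\sigma_r(X_\square^{(l)})}},$$ or $r=r_\star$ and $2\alpha^{(l)}=\beta^{(l)}$ (so that $\sigma_r(X_\square^{(l)})=\frac{2\alpha^{(l)}}{\beta^{(l)}}\sigma_{r_\star}(X_\square^{(l)})$ and $X_\square^{(l)}=\Pi_{\mathrm{rank}\le r_\star}(X_\square^{(l)})$). -/

import Mathlib

-- Matrices carry the Frobenius norm.
attribute [local instance] Matrix.frobeniusNormedAddCommGroup Matrix.frobeniusNormedSpace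

namespace LoRA

noncomputable section

/-- Tuples `(X⁽¹⁾, …, X⁽ᴸ⁾)` with `X⁽ˡ⁾` a real `m l × n l` matrix. -/
abbrev MatTuple {L : ℕ} (m n : Fin L → ℕ) : Type :=
  (l : Fin L) → Matrix (Fin (m l)) (Fin (n l)) ℝ

/-- Matrix inner product `⟨A, B⟩ = tr (Aᵀ B)`. -/
def matInner {p q : ℕ} (A B : Matrix (Fin p) (Fin q) ℝ) : ℝ :=
  (A.transpose * B).trace

/-- The `k`-th largest singular value `σ_k(X)`, for `k ≥ 1`
(Mathlib's sequence of singular values is indexed from `0`). -/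
def singVal {p q : ℕ} (X : Matrix (Fin p) (Fin q) ℝ) (k : ℕ) : ℝ :=
  (Matrix.toEuclideanLin X).singularValues (k - 1)

/-- Nuclear norm: the sum of the singular values. -/
def nuclearNorm {p q : ℕ} (X : Matrix (Fin p) (Fin q) ℝ) : ℝ :=
  ∑ i ∈ Finset.range q, (Matrix.toEuclideanLin X).singularValues i

/-- `P` is a projection of `X` onto the set of matrices of rank at most `k`,
i.e. a closest such matrix in Frobenius norm. -/
def IsRankProjection {p q : ℕ} (k : ℕ) (X P : Matrix (Fin p) (Fin q) ℝ) : Prop :=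
  P.rank ≤ k ∧ ∀ Y : Matrix (Fin p) (Fin q) ℝ, Y.rank ≤ k → ‖X - P‖ ≤ ‖X - Y‖

variable {L : ℕ} {m n : Fin L → ℕ}

/-- Frobenius norm of a tuple: `(∑ l, ‖X⁽ˡ⁾‖_F²)^(1/2)`. -/
def tupleFrobNorm (X : MatTuple m n) : ℝ := Real.sqrt (∑ l, ‖X l‖ ^ 2)

/-- Rank of a tuple: the maximum of the ranks of its members. -/
def tupleRank (X : MatTuple m n) : ℕ := Finset.univ.sup fun l => (X l).rank

/-- Nuclear norm of a tuple: the sum of the nuclear norms of its members. -/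
def tupleNuclearNorm (X : MatTuple m n) : ℝ := ∑ l, nuclearNorm (X l)

/-- The function is (Fréchet) differentiable everywhere, and so is its derivative. -/
def TwiceDifferentiable {E : Type*} [NormedAddCommGroup E] [NormedSpace ℝ E] (f : E → ℝ) : Prop :=
  Differentiable ℝ f ∧ Differentiable ℝ (fderiv ℝ f)

/-- Second-order stationary point: the gradient vanishes and the Hessian is positive
semidefinite. -/
def IsSOSP {E : Type*} [NormedAddCommGroup E] [NormedSpace ℝ E] (f : E → ℝ) (x : E) : Prop :=
  fderiv ℝ f x = 0 ∧ ∀ u : E, 0 ≤ fderiv ℝ (fderiv ℝ f) x u u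

/-- The gradient `∇_l f(X)` with respect to the `l`-th matrix, as the matrix of partial
derivatives with respect to the entries. -/
def partialGrad (f : MatTuple m n → ℝ) (X : MatTuple m n) (l : Fin L) :
    Matrix (Fin (m l)) (Fin (n l)) ℝ :=
  Matrix.of fun i j => fderiv ℝ f X (Pi.single l (Matrix.single i j 1))

/-- The quadratic form `∇²_{l,l} f(X)[H, H]` of the `l`-th diagonal block of the Hessian. -/
def partialHess (f : MatTuple m n → ℝ) (X : MatTuple m n) (l : Fin L)
    (H : Matrix (Fin (m l)) (Fin (n l)) ℝ) : ℝ :=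
  fderiv ℝ (fderiv ℝ f) X (Pi.single l H) (Pi.single l H)

/-- `f` is `(α, r, D)`-restricted strongly convex about `Xs`. -/
def RestrictedStronglyConvex (f : MatTuple m n → ℝ) (α : Fin L → ℝ) (r : ℕ) (D : ℝ)
    (Xs : MatTuple m n) : Prop :=
  ∀ l : Fin L, ∀ X : MatTuple m n, tupleFrobNorm (X - Xs) ≤ D → tupleRank X ≤ r →
    α l * ‖X l - Xs l‖ ^ 2 ≤ matInner (partialGrad f X l - partialGrad f Xs l) (X l - Xs l)

/-- `f` is `(β, r, D)`-restricted smooth about `Xs`. -/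
def RestrictedSmooth (f : MatTuple m n → ℝ) (β : Fin L → ℝ) (r : ℕ) (D : ℝ)
    (Xs : MatTuple m n) : Prop :=
  ∀ l : Fin L, ∀ X : MatTuple m n, tupleFrobNorm (X - Xs) ≤ D → tupleRank X ≤ r →
    ∀ (U : Matrix (Fin (m l)) (Fin (m l)) ℝ) (V : Matrix (Fin (n l)) (Fin (n l)) ℝ),
      U.rank = 1 → ‖U‖ = 1 → V.rank = 1 → ‖V‖ = 1 →
      partialHess f X l (U * X l + X l * V) ≤ β l * ‖U * X l + X l * V‖ ^ 2

/-- The tuple `A Bᵀ = (A⁽¹⁾ (B⁽¹⁾)ᵀ, …, A⁽ᴸ⁾ (B⁽ᴸ⁾)ᵀ)`. -/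
def loraProd {r : ℕ} (A : MatTuple m fun _ => r) (B : MatTuple n fun _ => r) : MatTuple m n :=
  fun l => A l * (B l).transpose

/-- Full fine-tuning loss with nuclear norm regularization. -/
def fullLoss (f : MatTuple m n → ℝ) (lam : ℝ) (X : MatTuple m n) : ℝ :=
  f X + lam * tupleNuclearNorm X

/-- LoRA loss with weight decay, as a function of the pair `(A, B)`. -/
def loraLoss (f : MatTuple m n → ℝ) (lam : ℝ) (r : ℕ)
    (AB : MatTuple m (fun _ => r) × MatTuple n (fun _ => r)) : ℝ :=
  f (loraProd AB.1 AB.2) + lam / 2 * (tupleFrobNorm AB.1 ^ 2 + tupleFrobNorm AB.2 ^ 2)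

/-- `X` is a global minimizer of `F`. -/
def IsGlobalMin {E : Type*} (F : E → ℝ) (x : E) : Prop := ∀ y : E, F x ≤ F y

end

end LoRA

/-! The argument is made block by block. Let `X = A Bᵀ` be a block of the stationary point, `Y` the
same block of the minimizer, `G` the partial gradient at the stationary point. Stationarity reads `G
B = -λ A`, `Gᵀ A = -λ B`, whence `G Q = -λ P` and `Gᵀ P = -λ Q` for the singular vectors `P`, `Q` of
`X` with positive singular values. So `-G` is a subgradient of `λ‖·‖_*` at `X` once it is bounded by
`λ` on the orthogonal complements of `P` and `Q`; restricted strong convexity and the optimality of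
`Y` then force `X = Y`.

If `rank X < r`, the factors have a spare direction and the second-order condition gives that bound
(`opBound_neg_of_rank_lt`). If `rank X = r`, perturbing along the `r`-th singular pair costs
curvature and gives only `λ + c` with `c = max (β σ_r) 0` (`IsThinSVD.neg_two_mul_grad_le`). The
excess is `c E` with a contraction `E` living on the complements (`exists_opBound_split`), so that
`α‖X - Y‖² ≤ c⟨E, Y⟩` (`mul_norm_sq_le_of_opBound`); if `X ≠ Y` this makes `c = β σ_r` positive. A
sharpened Eckart–Young inequality, `‖X - ΠX‖² + 2 σ_k ⟨E, Y⟩ ≤ ‖X - Y‖²` for `rank Y ≤ k`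
(`IsThinSVD.sum_add_le_norm_sub_sq`), turns this into `β σ_r ‖X - ΠX‖² ≤ (β σ_r - 2 α σ_k) ‖X -
Y‖²`, from which both regimes are read off using `σ_r ≤ σ_k`. -/

namespace LoRA

open Matrix

/-! ### The trace inner product and the Frobenius norm. -/

section MatInner

variable {p q r : ℕ}

theorem matInner_eq_sum (A B : Matrix (Fin p) (Fin q) ℝ) :
    matInner A B = ∑ i, ∑ j, A i j * B i j := by
  simp only [matInner, trace, diag_apply, mul_apply, transpose_apply]
  exact Finset.sum_comm

theorem matInner_comm (A B : Matrix (Fin p) (Fin q) ℝ) : matInner A B = matInner B A := by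
  simp only [matInner_eq_sum, mul_comm]

theorem matInner_add_left (A B C : Matrix (Fin p) (Fin q) ℝ) :
    matInner (A + B) C = matInner A C + matInner B C := by
  simp [matInner, Matrix.add_mul]

theorem matInner_sub_left (A B C : Matrix (Fin p) (Fin q) ℝ) :
    matInner (A - B) C = matInner A C - matInner B C := by
  simp [matInner, Matrix.sub_mul]

theorem matInner_neg_left (A C : Matrix (Fin p) (Fin q) ℝ) :
    matInner (-A) C = -matInner A C := by
  simp [matInner]

theorem matInner_smul_left (c : ℝ) (A C : Matrix (Fin p) (Fin q) ℝ) :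
    matInner (c • A) C = c * matInner A C := by
  simp [matInner]

theorem matInner_add_right (A B C : Matrix (Fin p) (Fin q) ℝ) :
    matInner A (B + C) = matInner A B + matInner A C := by
  simp [matInner, Matrix.mul_add]

theorem matInner_sub_right (A B C : Matrix (Fin p) (Fin q) ℝ) :
    matInner A (B - C) = matInner A B - matInner A C := by
  simp [matInner, Matrix.mul_sub]

theorem matInner_smul_right (c : ℝ) (A C : Matrix (Fin p) (Fin q) ℝ) :
    matInner A (c • C) = c * matInner A C := by
  simp [matInner]

theorem norm_sq_eq_matInner (A : Matrix (Fin p) (Fin q) ℝ) : ‖A‖ ^ 2 = matInner A A := by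
  rw [frobenius_norm_def, ← Real.sqrt_eq_rpow, Real.sq_sqrt (by positivity), matInner_eq_sum]
  simp [← sq]

theorem norm_sub_sq_eq (A B : Matrix (Fin p) (Fin q) ℝ) :
    ‖A - B‖ ^ 2 = ‖A‖ ^ 2 - 2 * matInner A B + ‖B‖ ^ 2 := by
  simp only [norm_sq_eq_matInner, matInner_sub_left, matInner_sub_right, matInner_comm B A]
  ring

theorem norm_sq_eq_sum_col (A : Matrix (Fin p) (Fin q) ℝ) :
    ‖A‖ ^ 2 = ∑ k, (fun i => A i k) ⬝ᵥ (fun i => A i k) := by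
  rw [norm_sq_eq_matInner, matInner_eq_sum, Finset.sum_comm]
  rfl

theorem matInner_mul_left (A : Matrix (Fin p) (Fin r) ℝ) (B : Matrix (Fin r) (Fin q) ℝ)
    (C : Matrix (Fin p) (Fin q) ℝ) : matInner (A * B) C = matInner B (Aᵀ * C) := by
  simp [matInner, Matrix.mul_assoc]

theorem matInner_mul_right (A : Matrix (Fin p) (Fin r) ℝ) (B : Matrix (Fin r) (Fin q) ℝ)
    (C : Matrix (Fin p) (Fin q) ℝ) : matInner C (A * B) = matInner (Aᵀ * C) B := by
  rw [matInner_comm, matInner_mul_left, matInner_comm]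

theorem matInner_transpose (A B : Matrix (Fin p) (Fin q) ℝ) :
    matInner Aᵀ Bᵀ = matInner A B := by
  rw [matInner_eq_sum, matInner_eq_sum, Finset.sum_comm]
  rfl

theorem matInner_mul_transpose (H : Matrix (Fin p) (Fin q) ℝ) (A : Matrix (Fin p) (Fin r) ℝ)
    (B : Matrix (Fin q) (Fin r) ℝ) :
    matInner H (A * Bᵀ) = ∑ k, (fun i => A i k) ⬝ᵥ H *ᵥ (fun j => B j k) := by
  rw [matInner_mul_right, ← matInner_transpose, transpose_transpose, transpose_mul,
    transpose_transpose, matInner_comm, matInner_eq_sum, Finset.sum_comm]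
  refine Finset.sum_congr rfl fun k _ => ?_
  rw [dotProduct_mulVec, dotProduct_comm]
  refine Finset.sum_congr rfl fun j _ => ?_
  simp [vecMul, dotProduct, mul_apply, mul_comm]

theorem matInner_vecMulVec (H : Matrix (Fin p) (Fin q) ℝ) (u : Fin p → ℝ) (v : Fin q → ℝ) :
    matInner H (vecMulVec u v) = u ⬝ᵥ H *ᵥ v := by
  rw [matInner_eq_sum]
  simp only [dotProduct, mulVec, vecMulVec_apply, Finset.mul_sum]
  exact Finset.sum_congr rfl fun i _ => Finset.sum_congr rfl fun j _ => by ring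

theorem norm_vecMulVec_sq (u : Fin p → ℝ) (v : Fin q → ℝ) :
    ‖vecMulVec u v‖ ^ 2 = (u ⬝ᵥ u) * (v ⬝ᵥ v) := by
  rw [norm_sq_eq_matInner, matInner_vecMulVec, vecMulVec_mulVec]
  simp [dotProduct_smul, mul_comm]

end MatInner

/-! ### Singular value decomposition; duality of operator and nuclear norm. -/

section SVD

variable {p q r : ℕ}

/-- `X = P diag(s) Qᵀ` is a singular value decomposition of `X` with positive, decreasing `s`. -/
structure IsThinSVD (X : Matrix (Fin p) (Fin q) ℝ) (P : Matrix (Fin p) (Fin r) ℝ)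
    (s : Fin r → ℝ) (Q : Matrix (Fin q) (Fin r) ℝ) : Prop where
  left : Pᵀ * P = 1
  right : Qᵀ * Q = 1
  eq : X = P * diagonal s * Qᵀ
  pos : ∀ i, 0 < s i
  anti : Antitone s

theorem finrank_range_toEuclideanLin (X : Matrix (Fin p) (Fin q) ℝ) :
    Module.finrank ℝ (LinearMap.range (Matrix.toEuclideanLin X)) = X.rank := by
  rw [X.rank_eq_finrank_range_toLin (PiLp.basisFun 2 ℝ _) (PiLp.basisFun 2 ℝ _),
    ← Matrix.toLpLin_eq_toLin]

theorem exists_isThinSVD (X : Matrix (Fin p) (Fin q) ℝ) (hr : X.rank = r) :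
    ∃ (P : Matrix (Fin p) (Fin r) ℝ) (Q : Matrix (Fin q) (Fin r) ℝ),
      IsThinSVD X P (fun i => (Matrix.toEuclideanLin X).singularValues i) Q := by
  set T := Matrix.toEuclideanLin X with hT
  have hn : Module.finrank ℝ (EuclideanSpace ℝ (Fin q)) = q := by simp
  have hrq : r ≤ q := by
    rw [← hr]; simpa using X.rank_le_width
  have hpos : ∀ i : ℕ, 0 < T.singularValues i ↔ i < r := fun i => by
    rw [T.singularValues_pos_iff_lt_finrank_range, hT, finrank_range_toEuclideanLin, hr]
  -- Right singular vectors are eigenvectors of `T* T`; their images under `T` are orthogonal with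
  -- lengths the singular values, so dividing by these gives `P`.
  let v := T.isSymmetric_adjoint_comp_self.eigenvectorBasis hn
  have hv : ∀ i j, inner ℝ (T (v i)) (T (v j)) = if i = j then T.singularValues i ^ 2 else 0 := by
    intro i j
    rw [← LinearMap.adjoint_inner_right]
    have := T.isSymmetric_adjoint_comp_self.apply_eigenvectorBasis hn j
    rw [LinearMap.comp_apply] at this
    rw [this, inner_smul_right, orthonormal_iff_ite.1 v.orthonormal i j,
      ← T.sq_singularValues_fin hn]
    split_ifs with h
    · subst h; simp
    · simp
  let Q0 : Matrix (Fin q) (Fin q) ℝ := Matrix.of fun a i => v i a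
  have hQ0 : Q0ᵀ * Q0 = 1 := by
    ext i j
    have := orthonormal_iff_ite.1 v.orthonormal j i
    rw [PiLp.inner_apply] at this
    simp only [mul_apply, transpose_apply, one_apply]
    simp only [eq_comm (a := i)]
    rw [← this]
    simp [Q0]
  have hQ0' : Q0 * Q0ᵀ = 1 := mul_eq_one_comm.1 hQ0
  have hXQ : ∀ a i, (X * Q0) a i = T (v i) a := by
    intro a i
    simp [hT, mul_apply, Q0, toLpLin_apply, mulVec, dotProduct]
  have hzero : ∀ i : Fin q, r ≤ i → ∀ a, (X * Q0) a i = 0 := by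
    intro i hi a
    have h0 : T.singularValues i = 0 := by
      have := (hpos i).not.2 (by omega)
      exact le_antisymm (not_lt.1 this) (T.singularValues_nonneg i)
    have := hv i i
    rw [if_pos rfl, h0] at this
    have : T (v i) = 0 := by simpa using this
    rw [hXQ, this]; rfl
  let e : Fin r → Fin q := Fin.castLE hrq
  let Q : Matrix (Fin q) (Fin r) ℝ := Q0.submatrix id e
  let P : Matrix (Fin p) (Fin r) ℝ :=
    Matrix.of fun a i => (T.singularValues (i : ℕ))⁻¹ * (X * Q0) a (e i)
  have hsne : ∀ i : Fin r, T.singularValues (i : ℕ) ≠ 0 := fun i => ((hpos i).2 i.2).ne'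
  refine ⟨P, Q, ?_, ?_, ?_, fun i => (hpos i).2 i.2, fun i j h => T.singularValues_antitone h⟩
  · ext i j
    have := hv (e j) (e i)
    rw [PiLp.inner_apply] at this
    simp only [mul_apply, transpose_apply, P, of_apply]
    have h2 : ∀ a, (T.singularValues (i : ℕ))⁻¹ * (X * Q0) a (e i) *
        ((T.singularValues (j : ℕ))⁻¹ * (X * Q0) a (e j)) =
        (T.singularValues (i : ℕ))⁻¹ * (T.singularValues (j : ℕ))⁻¹ *
          (inner ℝ (T (v (e j)) a) (T (v (e i)) a)) := by
      intro a
      rw [hXQ, hXQ]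
      simp
      ring
    have h3 := fun a => h2 a
    simp only [mul_apply] at h3
    rw [Finset.sum_congr rfl fun a _ => h3 a, ← Finset.mul_sum, this, one_apply]
    by_cases h : i = j
    · subst h
      have := hsne i
      simp [e]
      field_simp
    · have : e j ≠ e i := fun h' => h (Fin.castLE_injective hrq h').symm
      simp [h, this]
  · ext i j
    have := congrFun (congrFun hQ0 (e i)) (e j)
    simp only [mul_apply, transpose_apply, one_apply] at this
    simp only [mul_apply, transpose_apply, one_apply, Q, submatrix_apply, id]
    rw [this]
    simp [e]
  · have h1 : X = X * Q0 * Q0ᵀ := by rw [Matrix.mul_assoc, hQ0', Matrix.mul_one]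
    ext a b
    have h2 := congrFun (congrFun h1 a) b
    rw [h2, mul_apply, mul_apply]
    symm
    apply Fintype.sum_of_injective e (Fin.castLE_injective hrq)
    · intro i hi
      rw [hzero i, zero_mul]
      by_contra h
      exact hi ⟨⟨i, by omega⟩, rfl⟩
    · intro i
      have := hsne i
      rw [mul_diagonal]
      simp only [P, Q, of_apply, transpose_apply, submatrix_apply, id]
      field_simp

theorem nuclearNorm_eq_sum (X : Matrix (Fin p) (Fin q) ℝ) (hr : X.rank = r) :
    nuclearNorm X = ∑ i : Fin r, (Matrix.toEuclideanLin X).singularValues i := by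
  rw [nuclearNorm, Fin.sum_univ_eq_sum_range (fun i => (Matrix.toEuclideanLin X).singularValues i)]
  have hrq : r ≤ q := by
    rw [← hr]; simpa using X.rank_le_width
  symm
  apply Finset.sum_subset (Finset.range_subset_range.2 hrq)
  intro i _ hi
  rw [LinearMap.singularValues_eq_zero_iff_le_finrank_range, finrank_range_toEuclideanLin, hr]
  simpa using hi

theorem dotProduct_mulVec_transpose (P : Matrix (Fin p) (Fin r) ℝ) (u : Fin p → ℝ)
    (x : Fin r → ℝ) : u ⬝ᵥ P *ᵥ x = Pᵀ *ᵥ u ⬝ᵥ x := by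
  rw [dotProduct_mulVec, mulVec_transpose]

/-- The operator norm of `H` is at most `c`, expressed as a bound on the bilinear form. -/
def OpBound (H : Matrix (Fin p) (Fin q) ℝ) (c : ℝ) : Prop :=
  ∀ (u : Fin p → ℝ) (v : Fin q → ℝ), 2 * (u ⬝ᵥ H *ᵥ v) ≤ c * (u ⬝ᵥ u + v ⬝ᵥ v)

/-- The form `2 uᵀHv ≤ c (|u|² + |v|²)` adds up over matching columns of `A` and `B`. -/
theorem OpBound.matInner_mul_transpose_le {H : Matrix (Fin p) (Fin q) ℝ} {c : ℝ}
    (hH : OpBound H c) (A : Matrix (Fin p) (Fin r) ℝ) (B : Matrix (Fin q) (Fin r) ℝ) :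
    2 * matInner H (A * Bᵀ) ≤ c * (‖A‖ ^ 2 + ‖B‖ ^ 2) := by
  rw [matInner_mul_transpose, norm_sq_eq_sum_col, norm_sq_eq_sum_col, ← Finset.sum_add_distrib,
    Finset.mul_sum, Finset.mul_sum]
  exact Finset.sum_le_sum fun k _ => hH _ _

/-- One half of the duality: apply the bound to each pair of unit singular vectors of `Y`. -/
theorem OpBound.matInner_le {H : Matrix (Fin p) (Fin q) ℝ} {c : ℝ}
    (hH : OpBound H c) (Y : Matrix (Fin p) (Fin q) ℝ) : matInner H Y ≤ c * nuclearNorm Y := by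
  obtain ⟨P, Q, h⟩ := exists_isThinSVD Y rfl
  rw [nuclearNorm_eq_sum Y rfl, h.eq, matInner_mul_transpose, Finset.mul_sum]
  rw [← h.eq]
  refine Finset.sum_le_sum fun k _ => ?_
  have h1 := hH (fun i => P i k) (fun j => Q j k)
  have hP := congrFun (congrFun h.left k) k
  have hQ := congrFun (congrFun h.right k) k
  rw [one_apply_eq] at hP hQ
  have hP' : (fun i => P i k) ⬝ᵥ (fun i => P i k) = 1 := hP
  have hQ' : (fun i => Q i k) ⬝ᵥ (fun i => Q i k) = 1 := hQ
  rw [hP', hQ'] at h1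
  have h2 : (fun i => (P * diagonal fun i : Fin Y.rank => (toEuclideanLin Y).singularValues i) i k)
      = (toEuclideanLin Y).singularValues k • (fun i => P i k) := by
    ext i; rw [mul_diagonal, Pi.smul_apply, smul_eq_mul, mul_comm]
  rw [h2, smul_dotProduct, smul_eq_mul, mul_comm c]
  exact mul_le_mul_of_nonneg_left (by linarith) (h.pos k).le

theorem exists_eq_add_of_left {P : Matrix (Fin p) (Fin r) ℝ} (hP : Pᵀ * P = 1) (u : Fin p → ℝ) :
    ∃ u' : Fin p → ℝ, Pᵀ *ᵥ u' = 0 ∧ u = P *ᵥ (Pᵀ *ᵥ u) + u' ∧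
      u ⬝ᵥ u = Pᵀ *ᵥ u ⬝ᵥ Pᵀ *ᵥ u + u' ⬝ᵥ u' := by
  have h0 : Pᵀ *ᵥ (u - P *ᵥ (Pᵀ *ᵥ u)) = 0 := by
    rw [mulVec_sub, mulVec_mulVec, hP, one_mulVec, sub_self]
  refine ⟨u - P *ᵥ (Pᵀ *ᵥ u), h0, by simp, ?_⟩
  have h1 : (u - P *ᵥ (Pᵀ *ᵥ u)) ⬝ᵥ (u - P *ᵥ (Pᵀ *ᵥ u)) =
      (u - P *ᵥ (Pᵀ *ᵥ u)) ⬝ᵥ u := by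
    rw [dotProduct_sub, dotProduct_mulVec_transpose, h0]; simp
  rw [h1, sub_dotProduct, dotProduct_comm (P *ᵥ _) u, dotProduct_mulVec_transpose P]
  ring

theorem opBound_mul_transpose {P : Matrix (Fin p) (Fin r) ℝ} {Q : Matrix (Fin q) (Fin r) ℝ}
    (hP : Pᵀ * P = 1) (hQ : Qᵀ * Q = 1) : OpBound (P * Qᵀ) 1 := by
  intro u v
  obtain ⟨u', -, -, hu⟩ := exists_eq_add_of_left hP u
  obtain ⟨v', -, -, hv⟩ := exists_eq_add_of_left hQ v
  rw [← mulVec_mulVec, dotProduct_mulVec_transpose]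
  have h1 : 0 ≤ (Pᵀ *ᵥ u - Qᵀ *ᵥ v) ⬝ᵥ (Pᵀ *ᵥ u - Qᵀ *ᵥ v) := dotProduct_self_star_nonneg _
  have h2 : 0 ≤ u' ⬝ᵥ u' := dotProduct_self_star_nonneg _
  have h3 : 0 ≤ v' ⬝ᵥ v' := dotProduct_self_star_nonneg _
  rw [sub_dotProduct, dotProduct_sub, dotProduct_sub,
    dotProduct_comm (Qᵀ *ᵥ v) (Pᵀ *ᵥ u)] at h1
  linarith

theorem IsThinSVD.matInner_mul_transpose {X : Matrix (Fin p) (Fin q) ℝ}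
    {P : Matrix (Fin p) (Fin r) ℝ} {s : Fin r → ℝ} {Q : Matrix (Fin q) (Fin r) ℝ}
    (h : IsThinSVD X P s Q) : matInner (P * Qᵀ) X = ∑ i, s i := by
  rw [h.eq, matInner, transpose_mul, transpose_transpose, Matrix.mul_assoc, ← Matrix.mul_assoc Pᵀ,
    ← Matrix.mul_assoc Pᵀ, h.left, Matrix.one_mul, trace_mul_comm, Matrix.mul_assoc, h.right,
    Matrix.mul_one, trace_diagonal]

/-- The other half: the supremum over contractions is attained at `P Qᵀ`. -/
theorem exists_opBound_one_matInner_eq (X : Matrix (Fin p) (Fin q) ℝ) :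
    ∃ H, OpBound H 1 ∧ matInner H X = nuclearNorm X := by
  obtain ⟨P, Q, h⟩ := exists_isThinSVD X rfl
  refine ⟨P * Qᵀ, opBound_mul_transpose h.left h.right, ?_⟩
  rw [nuclearNorm_eq_sum X rfl, h.matInner_mul_transpose]

/-- A supremum of linear forms is convex: compare all three norms through the form that is extremal
at the intermediate point. -/
theorem nuclearNorm_convex (X Y : Matrix (Fin p) (Fin q) ℝ) {t : ℝ} (h0 : 0 ≤ t) (h1 : t ≤ 1) :
    nuclearNorm (X + t • (Y - X)) ≤ nuclearNorm X + t * (nuclearNorm Y - nuclearNorm X) := by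
  obtain ⟨H, hH, h⟩ := exists_opBound_one_matInner_eq (X + t • (Y - X))
  rw [← h, matInner_add_right, matInner_smul_right, matInner_sub_right]
  have hX := hH.matInner_le X
  have hY := hH.matInner_le Y
  nlinarith

theorem nuclearNorm_mul_transpose_le (A : Matrix (Fin p) (Fin r) ℝ)
    (B : Matrix (Fin q) (Fin r) ℝ) :
    2 * nuclearNorm (A * Bᵀ) ≤ ‖A‖ ^ 2 + ‖B‖ ^ 2 := by
  obtain ⟨H, hH, h⟩ := exists_opBound_one_matInner_eq (A * Bᵀ)
  rw [← h]
  simpa using hH.matInner_mul_transpose_le A B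

end SVD

/-! ### Low-rank approximation and splitting off a contraction. -/

section LowRank

variable {p q r : ℕ}

theorem norm_sq_transpose_mul_diagonal {k : ℕ} (C : Matrix (Fin p) (Fin k) ℝ)
    (P : Matrix (Fin p) (Fin r) ℝ) (s : Fin r → ℝ) :
    ‖Cᵀ * (P * diagonal s)‖ ^ 2 = ∑ i, s i ^ 2 * (Cᵀ *ᵥ (fun a => P a i) ⬝ᵥ
      Cᵀ *ᵥ (fun a => P a i)) := by
  rw [norm_sq_eq_sum_col]
  refine Finset.sum_congr rfl fun i _ => ?_
  have : (fun a => (Cᵀ * (P * diagonal s)) a i) = s i • Cᵀ *ᵥ (fun a => P a i) := by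
    ext a
    rw [← Matrix.mul_assoc, mul_diagonal, Pi.smul_apply, smul_eq_mul, mul_comm]
    rfl
  rw [this, smul_dotProduct, dotProduct_smul, smul_eq_mul, smul_eq_mul]
  ring

theorem norm_sq_mul_transpose_of_orthonormal (C : Matrix (Fin p) (Fin r) ℝ)
    {Q : Matrix (Fin q) (Fin r) ℝ} (hQ : Qᵀ * Q = 1) : ‖C * Qᵀ‖ ^ 2 = ‖C‖ ^ 2 := by
  rw [norm_sq_eq_matInner, norm_sq_eq_matInner, ← matInner_transpose, transpose_mul,
    transpose_transpose, matInner_mul_left, ← Matrix.mul_assoc, hQ, Matrix.one_mul,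
    matInner_transpose]

theorem norm_sq_mul_of_orthonormal (C : Matrix (Fin r) (Fin q) ℝ)
    {P : Matrix (Fin p) (Fin r) ℝ} (hP : Pᵀ * P = 1) : ‖P * C‖ ^ 2 = ‖C‖ ^ 2 := by
  rw [norm_sq_eq_matInner, norm_sq_eq_matInner, matInner_mul_left, ← Matrix.mul_assoc, hP,
    Matrix.one_mul]

theorem dotProduct_self_transpose_mulVec_le {C : Matrix (Fin p) (Fin r) ℝ} (hC : Cᵀ * C = 1)
    (u : Fin p → ℝ) : Cᵀ *ᵥ u ⬝ᵥ Cᵀ *ᵥ u ≤ u ⬝ᵥ u := by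
  obtain ⟨u', -, -, hu⟩ := exists_eq_add_of_left hC u
  have h2 : 0 ≤ u' ⬝ᵥ u' := dotProduct_self_star_nonneg _
  linarith

theorem col_dotProduct_self {P : Matrix (Fin p) (Fin r) ℝ} (hP : Pᵀ * P = 1) (i : Fin r) :
    (fun a => P a i) ⬝ᵥ (fun a => P a i) = 1 := by
  have := congrFun (congrFun hP i) i
  rw [one_apply_eq] at this
  exact this

theorem norm_sq_eq_of_orthonormal {P : Matrix (Fin p) (Fin r) ℝ} (hP : Pᵀ * P = 1) :
    ‖P‖ ^ 2 = r := by
  rw [norm_sq_eq_sum_col]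
  simp [col_dotProduct_self hP]

/-- A contraction whose range is orthogonal to the columns of `P` is dominated by the projection
onto the orthogonal complement of these columns. -/
theorem OpBound.transpose_mulVec_le {E : Matrix (Fin p) (Fin q) ℝ} (hE : OpBound E 1)
    {P : Matrix (Fin p) (Fin r) ℝ} (hP : Pᵀ * P = 1) (hPE : Pᵀ * E = 0) (u : Fin p → ℝ) :
    Eᵀ *ᵥ u ⬝ᵥ Eᵀ *ᵥ u + Pᵀ *ᵥ u ⬝ᵥ Pᵀ *ᵥ u ≤ u ⬝ᵥ u := by
  obtain ⟨u', -, hu, hu'⟩ := exists_eq_add_of_left hP u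
  have h0 : Eᵀ *ᵥ u = Eᵀ *ᵥ u' := by
    conv_lhs => rw [hu]
    have : Eᵀ * P = 0 := by
      rw [← transpose_transpose P, ← transpose_mul, hPE, transpose_zero]
    rw [mulVec_add, mulVec_mulVec, this, zero_mulVec, zero_add]
  -- This choice of test vector gives `2|Eᵀu'|² ≤ |u'|² + |Eᵀu'|²`.
  have h1 := hE u' (Eᵀ *ᵥ u')
  rw [dotProduct_mulVec_transpose, one_mul] at h1
  rw [h0, hu']
  linarith

/-- If the columns of `X` and `E` are orthogonal, where `E` is a contraction, then `Y` of rank at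
most `k` approximates `X` no better than the best such matrix, with a gain in the component of `Y`
along `E`. -/
theorem IsThinSVD.sum_add_le_norm_sub_sq {X : Matrix (Fin p) (Fin q) ℝ}
    {P : Matrix (Fin p) (Fin r) ℝ} {s : Fin r → ℝ} {Q : Matrix (Fin q) (Fin r) ℝ}
    (h : IsThinSVD X P s Q) {k : ℕ} {t : ℝ} (ht : 0 ≤ t) (hk : k ≤ r)
    (hlt : ∀ i : Fin r, (i : ℕ) < k → t ≤ s i) (hge : ∀ i : Fin r, k ≤ (i : ℕ) → s i ≤ t)
    {E : Matrix (Fin p) (Fin q) ℝ} (hE : OpBound E 1) (hPE : Pᵀ * E = 0) (hEQ : E * Q = 0)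
    {Y : Matrix (Fin p) (Fin q) ℝ} (hY : Y.rank ≤ k) :
    (∑ i : Fin r, if (i : ℕ) < k then 0 else s i ^ 2) + 2 * t * matInner E Y ≤ ‖X - Y‖ ^ 2 := by
  obtain ⟨C, Q', h'⟩ := exists_isThinSVD Y rfl
  set D := diagonal (fun i : Fin Y.rank => (toEuclideanLin Y).singularValues i) * Q'ᵀ with hD
  have hYC : Y = C * D := by
    have := h'.eq
    rw [hD, ← Matrix.mul_assoc]; exact this
  have hYD : ‖Y‖ ^ 2 = ‖D‖ ^ 2 := by
    have := norm_sq_mul_of_orthonormal D h'.left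
    rwa [← hYC] at this
  have hXn : ‖X‖ ^ 2 = ∑ i, s i ^ 2 := by
    rw [h.eq, norm_sq_mul_transpose_of_orthonormal _ h.right, norm_sq_eq_matInner,
      matInner_mul_left, ← Matrix.mul_assoc, h.left, Matrix.one_mul, matInner, diagonal_transpose,
      diagonal_mul_diagonal, trace_diagonal]
    simp [sq]
  -- `w i` is the squared length of the projection of the `i`-th left singular vector onto the
  -- column space of `Y`.
  set w : Fin r → ℝ := fun i => Cᵀ *ᵥ (fun a => P a i) ⬝ᵥ Cᵀ *ᵥ (fun a => P a i) with hw
  have hw0 : ∀ i, 0 ≤ w i := fun i => dotProduct_self_star_nonneg _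
  have hw1 : ∀ i, w i ≤ 1 := fun i => by
    rw [← col_dotProduct_self h.left i]
    exact dotProduct_self_transpose_mulVec_le h'.left _
  have hCX : ‖Cᵀ * X‖ ^ 2 = ∑ i, s i ^ 2 * w i := by
    rw [h.eq, ← Matrix.mul_assoc, norm_sq_mul_transpose_of_orthonormal _ h.right,
      norm_sq_transpose_mul_diagonal]
  have hCP : ‖Pᵀ * C‖ ^ 2 = ∑ i, w i := by
    rw [← frobenius_norm_transpose, transpose_mul, transpose_transpose]
    have := norm_sq_transpose_mul_diagonal C P (fun _ => 1)
    simpa using this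
  -- The `Y.rank` unit columns of `C` are a budget shared by the orthogonal ranges of `P` and `E`.
  have hCE : ‖Cᵀ * E‖ ^ 2 + ‖Pᵀ * C‖ ^ 2 ≤ Y.rank := by
    rw [← frobenius_norm_transpose (Cᵀ * E), transpose_mul, transpose_transpose,
      ← norm_sq_eq_of_orthonormal h'.left, norm_sq_eq_sum_col, norm_sq_eq_sum_col,
      norm_sq_eq_sum_col, ← Finset.sum_add_distrib]
    exact Finset.sum_le_sum fun j _ => hE.transpose_mulVec_le h.left hPE (fun a => C a j)
  have hcross : matInner (Cᵀ * X) (Cᵀ * E) = 0 := by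
    have hEX : E * Xᵀ = 0 := by
      rw [h.eq, transpose_mul, transpose_transpose, ← Matrix.mul_assoc, hEQ, Matrix.zero_mul]
    rw [matInner_comm, ← matInner_transpose, transpose_mul, transpose_mul, transpose_transpose,
      matInner_mul_left, transpose_transpose, ← Matrix.mul_assoc, hEX, Matrix.zero_mul]
    simp [matInner]
  -- Completing the square: this says `2⟨X + tE, Y⟩ - ‖Y‖² ≤ ‖Cᵀ(X + tE)‖²`.
  have hZ : 0 ≤ ‖(Cᵀ * X + t • (Cᵀ * E)) - D‖ ^ 2 := by positivity
  have hXY : matInner X Y = matInner (Cᵀ * X) D := by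
    conv_lhs => rw [hYC, matInner_mul_right]
  have hEY : matInner E Y = matInner (Cᵀ * E) D := by
    conv_lhs => rw [hYC, matInner_mul_right]
  rw [norm_sub_sq_eq, matInner_add_left, matInner_smul_left, ← hXY, ← hEY, ← hYD] at hZ
  have hZ' : ‖Cᵀ * X + t • (Cᵀ * E)‖ ^ 2 = ‖Cᵀ * X‖ ^ 2 + t ^ 2 * ‖Cᵀ * E‖ ^ 2 := by
    rw [norm_sq_eq_matInner, matInner_add_left, matInner_add_right, matInner_add_right,
      matInner_smul_left, matInner_smul_left, matInner_smul_right, matInner_smul_right,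
      matInner_comm (Cᵀ * E) (Cᵀ * X), hcross, ← norm_sq_eq_matInner, ← norm_sq_eq_matInner]
    ring
  have hrank : (Y.rank : ℝ) ≤ k := by exact_mod_cast hY
  -- With `k` written as a sum of indicators this holds term by term: `0 ≤ w i ≤ 1`, and `t`
  -- separates the first `k` singular values from the rest.
  have hsum : ∑ i, s i ^ 2 * w i + t ^ 2 * (k - ∑ i, w i) +
      (∑ i : Fin r, if (i : ℕ) < k then 0 else s i ^ 2) ≤ ∑ i, s i ^ 2 := by
    have hkc : (k : ℝ) = ∑ i : Fin r, if (i : ℕ) < k then 1 else 0 := by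
      rw [Fin.sum_univ_eq_sum_range (fun i => if i < k then (1 : ℝ) else 0), Finset.sum_ite]
      have : (Finset.range r).filter (· < k) = Finset.range k := by
        ext i; simp; omega
      simp [this]
    rw [hkc, ← Finset.sum_sub_distrib, Finset.mul_sum, ← Finset.sum_add_distrib,
      ← Finset.sum_add_distrib]
    refine Finset.sum_le_sum fun i _ => ?_
    have hs := h.pos i
    have h0 := hw0 i
    have h1 := hw1 i
    split_ifs with hi
    · have := hlt i hi
      nlinarith [mul_nonneg (sub_nonneg.2 h1) (sub_nonneg.2 (pow_le_pow_left₀ ht this 2))]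
    · have := hge i (not_lt.1 hi)
      nlinarith [mul_nonneg h0 (sub_nonneg.2 (pow_le_pow_left₀ hs.le this 2))]
  have hfin : t ^ 2 * ‖Cᵀ * E‖ ^ 2 ≤ t ^ 2 * (k - ∑ i, w i) :=
    mul_le_mul_of_nonneg_left (by linarith) (by positivity)
  rw [norm_sub_sq_eq, hXn]
  rw [hZ', hCX] at hZ
  linarith

theorem opBound_zero : OpBound (0 : Matrix (Fin p) (Fin q) ℝ) 1 := by
  intro u v
  have h2 : 0 ≤ u ⬝ᵥ u := dotProduct_self_star_nonneg _
  have h3 : 0 ≤ v ⬝ᵥ v := dotProduct_self_star_nonneg _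
  simp only [zero_mulVec, dotProduct_zero]
  linarith

/-- Truncating the singular value decomposition gives a best approximation of given rank. -/
theorem IsThinSVD.exists_isRankProjection {X : Matrix (Fin p) (Fin q) ℝ}
    {P : Matrix (Fin p) (Fin r) ℝ} {s : Fin r → ℝ} {Q : Matrix (Fin q) (Fin r) ℝ}
    (h : IsThinSVD X P s Q) {k : ℕ} (hk0 : 1 ≤ k) (hk : k ≤ r) :
    ∃ Y, IsRankProjection k X Y ∧
      ‖X - Y‖ ^ 2 = ∑ i : Fin r, if (i : ℕ) < k then 0 else s i ^ 2 := by
  set d : Fin r → ℝ := fun i => if (i : ℕ) < k then s i else 0 with hd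
  have hnorm : ‖X - P * diagonal d * Qᵀ‖ ^ 2 =
      ∑ i : Fin r, if (i : ℕ) < k then 0 else s i ^ 2 := by
    rw [h.eq, ← Matrix.sub_mul, ← Matrix.mul_sub, norm_sq_mul_transpose_of_orthonormal _ h.right,
      norm_sq_mul_of_orthonormal _ h.left, norm_sq_eq_matInner, diagonal_sub, matInner,
      diagonal_transpose, diagonal_mul_diagonal, trace_diagonal]
    refine Finset.sum_congr rfl fun i _ => ?_
    simp only [hd]
    split_ifs <;> ring
  refine ⟨P * diagonal d * Qᵀ, ⟨?_, fun Y hY => ?_⟩, hnorm⟩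
  · calc (P * diagonal d * Qᵀ).rank ≤ (P * diagonal d).rank := rank_mul_le_left _ _
      _ ≤ (diagonal d).rank := rank_mul_le_right _ _
      _ = Fintype.card {i // d i ≠ 0} := rank_diagonal _
      _ ≤ Fintype.card (Fin k) := by
        refine Fintype.card_le_of_injective (fun i => (⟨i.1.1, ?_⟩ : Fin k)) ?_
        · by_contra hi
          exact i.2 (if_neg hi)
        · intro i j hij
          exact Subtype.ext (Fin.ext (Fin.mk.inj hij))
      _ = k := Fintype.card_fin k
  -- Eckart–Young is the case `E = 0`, with `t` the `k`-th singular value, which has index `k - 1`.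
  · have := h.sum_add_le_norm_sub_sq (h.pos ⟨k - 1, by omega⟩).le hk
      (fun i hi => h.anti (Fin.mk_le_mk.2 (by omega) : i ≤ ⟨k - 1, by omega⟩))
      (fun i hi => h.anti (Fin.mk_le_mk.2 (by omega) : ⟨k - 1, by omega⟩ ≤ i))
      opBound_zero (Matrix.mul_zero _) (Matrix.zero_mul _) hY
    rw [← hnorm] at this
    refine le_of_sq_le_sq (h := ?_) (norm_nonneg _)
    simpa [matInner] using this

/-- Splitting of a matrix `G` that acts as `-λ P Qᵀ` on the columns of `P` and `Q`, and is bounded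
by `λ + c` on their orthogonal complements. -/
theorem exists_opBound_split {G : Matrix (Fin p) (Fin q) ℝ} {P : Matrix (Fin p) (Fin r) ℝ}
    {Q : Matrix (Fin q) (Fin r) ℝ} (hP : Pᵀ * P = 1) (hQ : Qᵀ * Q = 1) {lam c : ℝ}
    (hlam : 0 ≤ lam) (hc : 0 ≤ c) (hGQ : G * Q = -(lam • P)) (hGP : Gᵀ * P = -(lam • Q))
    (hG : ∀ u v, Pᵀ *ᵥ u = 0 → Qᵀ *ᵥ v = 0 →
      -2 * (u ⬝ᵥ G *ᵥ v) ≤ (lam + c) * (u ⬝ᵥ u + v ⬝ᵥ v)) :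
    ∃ E, OpBound E 1 ∧ Pᵀ * E = 0 ∧ E * Q = 0 ∧ OpBound (-G - c • E) lam := by
  -- `F` is what remains of `-G` on the complements, bounded there by `lam + c`. With `E = F / (lam
  -- + c)`, the matrix `-G - c E` is `lam` times the sum of `P Qᵀ` and `E`, contractions with
  -- orthogonal supports.
  set F := -G - lam • (P * Qᵀ) with hF
  have hFQ : F * Q = 0 := by
    rw [hF, Matrix.sub_mul, Matrix.neg_mul, hGQ, Matrix.smul_mul, Matrix.mul_assoc, hQ,
      Matrix.mul_one, neg_neg, sub_self]
  have hPG : Pᵀ * G = -(lam • Qᵀ) := by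
    rw [← transpose_transpose G, ← transpose_mul, hGP, transpose_neg, transpose_smul]
  have hPF : Pᵀ * F = 0 := by
    rw [hF, Matrix.mul_sub, Matrix.mul_neg, hPG, Matrix.mul_smul, ← Matrix.mul_assoc, hP,
      Matrix.one_mul, neg_neg, sub_self]
  -- `a` and `b` are the parts of `|u|² + |v|²` inside the column spans of `P`, `Q` and inside their
  -- complements.
  have key : ∀ u v, ∃ a b : ℝ, 0 ≤ a ∧ 0 ≤ b ∧ 2 * (u ⬝ᵥ F *ᵥ v) ≤ (lam + c) * b ∧
      2 * (u ⬝ᵥ (P * Qᵀ) *ᵥ v) ≤ a ∧ a + b = u ⬝ᵥ u + v ⬝ᵥ v := by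
    intro u v
    obtain ⟨u', hu0, hu, hu'⟩ := exists_eq_add_of_left hP u
    obtain ⟨v', hv0, hv, hv'⟩ := exists_eq_add_of_left hQ v
    have n1 : 0 ≤ u' ⬝ᵥ u' := dotProduct_self_star_nonneg _
    have n2 : 0 ≤ v' ⬝ᵥ v' := dotProduct_self_star_nonneg _
    have n3 : 0 ≤ Pᵀ *ᵥ u ⬝ᵥ Pᵀ *ᵥ u := dotProduct_self_star_nonneg _
    have n4 : 0 ≤ Qᵀ *ᵥ v ⬝ᵥ Qᵀ *ᵥ v := dotProduct_self_star_nonneg _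
    refine ⟨Pᵀ *ᵥ u ⬝ᵥ Pᵀ *ᵥ u + Qᵀ *ᵥ v ⬝ᵥ Qᵀ *ᵥ v, u' ⬝ᵥ u' + v' ⬝ᵥ v', by positivity,
      by positivity, ?_, ?_, by rw [hu', hv']; ring⟩
    · have h1 : u ⬝ᵥ F *ᵥ v = u' ⬝ᵥ F *ᵥ v' := by
        have e1 : F *ᵥ v = F *ᵥ v' := by
          conv_lhs => rw [hv]
          rw [mulVec_add, mulVec_mulVec, hFQ, zero_mulVec, zero_add]
        rw [e1]
        conv_lhs => rw [hu]
        rw [add_dotProduct, dotProduct_comm (P *ᵥ _), dotProduct_mulVec_transpose, mulVec_mulVec,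
          hPF, zero_mulVec, zero_dotProduct, zero_add]
      have h2 : u' ⬝ᵥ F *ᵥ v' = -(u' ⬝ᵥ G *ᵥ v') := by
        rw [hF, sub_mulVec, smul_mulVec, ← mulVec_mulVec, hv0]
        simp [neg_mulVec]
      rw [h1, h2]
      linarith [hG u' v' hu0 hv0]
    · rw [← mulVec_mulVec, dotProduct_mulVec_transpose]
      have h1 : 0 ≤ (Pᵀ *ᵥ u - Qᵀ *ᵥ v) ⬝ᵥ (Pᵀ *ᵥ u - Qᵀ *ᵥ v) := dotProduct_self_star_nonneg _
      rw [sub_dotProduct, dotProduct_sub, dotProduct_sub,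
        dotProduct_comm (Qᵀ *ᵥ v) (Pᵀ *ᵥ u)] at h1
      linarith
  have hGF : -G = lam • (P * Qᵀ) + F := by rw [hF]; abel
  by_cases h0 : lam + c = 0
  · have hl : lam = 0 := by linarith
    have hc' : c = 0 := by linarith
    refine ⟨0, opBound_zero, Matrix.mul_zero _, Matrix.zero_mul _, fun u v => ?_⟩
    obtain ⟨a, b, ha, hb, h1, h2, h3⟩ := key u v
    rw [smul_zero, sub_zero, hGF, hl, zero_smul, zero_add]
    rw [h0] at h1
    linarith
  · have hpos : 0 < lam + c := lt_of_le_of_ne (by positivity) (Ne.symm h0)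
    refine ⟨(lam + c)⁻¹ • F, fun u v => ?_, by rw [Matrix.mul_smul, hPF, smul_zero],
      by rw [Matrix.smul_mul, hFQ, smul_zero], fun u v => ?_⟩
    · obtain ⟨a, b, ha, hb, h1, h2, h3⟩ := key u v
      rw [smul_mulVec, dotProduct_smul, smul_eq_mul, ← h3]
      have : (lam + c)⁻¹ * (2 * (u ⬝ᵥ F *ᵥ v)) ≤ (lam + c)⁻¹ * ((lam + c) * b) :=
        mul_le_mul_of_nonneg_left h1 (by positivity)
      rw [inv_mul_cancel_left₀ h0] at this
      linarith
    · obtain ⟨a, b, ha, hb, h1, h2, h3⟩ := key u v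
      have e : -G - c • (lam + c)⁻¹ • F = lam • (P * Qᵀ) + (lam * (lam + c)⁻¹) • F := by
        have : lam * (lam + c)⁻¹ = 1 - c * (lam + c)⁻¹ := by field_simp; ring
        rw [this, hGF, sub_smul, one_smul, smul_smul]; abel
      rw [e, add_mulVec, smul_mulVec, smul_mulVec, dotProduct_add, dotProduct_smul,
        dotProduct_smul, smul_eq_mul, smul_eq_mul, ← h3]
      have i1 : (lam * (lam + c)⁻¹) * (2 * (u ⬝ᵥ F *ᵥ v)) ≤
          (lam * (lam + c)⁻¹) * ((lam + c) * b) :=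
        mul_le_mul_of_nonneg_left h1 (by positivity)
      have i2 : lam * (2 * (u ⬝ᵥ (P * Qᵀ) *ᵥ v)) ≤ lam * a := mul_le_mul_of_nonneg_left h2 hlam
      have i3 : (lam * (lam + c)⁻¹) * ((lam + c) * b) = lam * b := by field_simp
      linarith

end LowRank

/-! ### Derivatives after a bilinear substitution. -/

section BilinearSubstitution

variable {E F : Type*} [NormedAddCommGroup E] [NormedSpace ℝ E]
  [NormedAddCommGroup F] [NormedSpace ℝ F]

/-- First and second order conditions at a second-order stationary point of
`x ↦ f (b x x) + c x x`, where `b` and `c` are bilinear. -/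
theorem IsSOSP.of_bilinear {f : F → ℝ} (hf : TwiceDifferentiable f) (b : E →L[ℝ] E →L[ℝ] F)
    (c : E →L[ℝ] E →L[ℝ] ℝ) {x : E} (hx : IsSOSP (fun x => f (b x x) + c x x) x) (u : E) :
    fderiv ℝ f (b x x) (b x u + b u x) + (c x u + c u x) = 0 ∧
    0 ≤ fderiv ℝ (fderiv ℝ f) (b x x) (b x u + b u x) (b x u + b u x) +
      2 * fderiv ℝ f (b x x) (b u u) + 2 * c u u := by
  have hb : ∀ y, HasFDerivAt (fun y => b y y) (b y + b.flip y) y := fun y => by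
    refine (b.hasFDerivAt.clm_apply (hasFDerivAt_id y)).congr_fderiv ?_
    ext v; simp
  have hc : ∀ y, HasFDerivAt (fun y => c y y) (c y + c.flip y) y := fun y => by
    refine (c.hasFDerivAt.clm_apply (hasFDerivAt_id y)).congr_fderiv ?_
    ext v; simp
  -- The first derivative is needed as a function, since it is differentiated again. `b` and `c`
  -- need not be symmetric, hence the flips.
  have h1 : fderiv ℝ (fun x => f (b x x) + c x x) =
      fun y => (fderiv ℝ f (b y y)).comp (b y + b.flip y) + (c y + c.flip y) := by
    funext y
    exact ((HasFDerivAt.comp (g := f) (f := fun y => b y y) y (hf.1 (b y y)).hasFDerivAt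
      (hb y)).add (hc y)).fderiv
  have hg := ((HasFDerivAt.comp (g := fderiv ℝ f) (f := fun y => b y y) x
    (hf.2 (b x x)).hasFDerivAt (hb x)).clm_comp
    ((b.hasFDerivAt (x := x)).add (b.flip.hasFDerivAt (x := x)))).add
    ((c.hasFDerivAt (x := x)).add (c.flip.hasFDerivAt (x := x)))
  have h2 := hx.2 u
  have h3 := congrArg (fun T => T u) hx.1
  rw [h1] at h2 h3
  have h4 := hg.fderiv
  refine ⟨by simpa using h3, ?_⟩
  have h5 : fderiv ℝ (fun y => (fderiv ℝ f (b y y)).comp (b y + b.flip y) + (c y + c.flip y)) x u u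
    = fderiv ℝ (fderiv ℝ f) (b x x) (b x u + b u x) (b x u + b u x) +
      2 * fderiv ℝ f (b x x) (b u u) + 2 * c u u := by
    refine (congrArg (fun T => T u u) h4).trans ?_
    simp
    ring
  rwa [h5] at h2

theorem hasDerivAt_comp_add_smul {f : E → ℝ} (hf : Differentiable ℝ f) (x w : E) :
    HasDerivAt (fun t : ℝ => f (x + t • w)) (fderiv ℝ f x w) 0 := by
  have h0 : HasDerivAt (fun t : ℝ => x + t • w) w 0 := by
    have := (hasDerivAt_id (0 : ℝ)).smul_const w
    rw [one_smul] at this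
    exact this.const_add x
  have h2 : HasFDerivAt f (fderiv ℝ f x) (x + (0 : ℝ) • w) := by
    rw [zero_smul, add_zero]; exact (hf x).hasFDerivAt
  exact h2.comp_hasDerivAt (0 : ℝ) h0

end BilinearSubstitution

/-! ### Stationarity conditions of the LoRA loss, one block at a time. -/

section Lora

variable {L : ℕ} {m n : Fin L → ℕ}

theorem fderiv_single_eq_matInner (f : MatTuple m n → ℝ) (X : MatTuple m n) (l : Fin L)
    (W : Matrix (Fin (m l)) (Fin (n l)) ℝ) :
    fderiv ℝ f X (Pi.single l W) = matInner (partialGrad f X l) W := by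
  conv_lhs => rw [matrix_eq_sum_single W]
  rw [matInner_eq_sum, ← LinearMap.single_apply (R := ℝ)
    (φ := fun l => Matrix (Fin (m l)) (Fin (n l)) ℝ), map_sum, map_sum]
  refine Finset.sum_congr rfl fun i _ => ?_
  rw [map_sum, map_sum]
  refine Finset.sum_congr rfl fun j _ => ?_
  have : Matrix.single i j (W i j) = W i j • Matrix.single i j (1 : ℝ) := by simp
  rw [this, map_smul, map_smul, smul_eq_mul, mul_comm]
  rfl

theorem tupleFrobNorm_sq (X : MatTuple m n) : tupleFrobNorm X ^ 2 = ∑ l, ‖X l‖ ^ 2 :=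
  Real.sq_sqrt (by positivity)

/-- The bilinear map `((A, B), (A', B')) ↦ A B'ᵀ`. -/
noncomputable def loraBilin (m n : Fin L → ℕ) (r : ℕ) :
    (MatTuple m (fun _ => r) × MatTuple n (fun _ => r)) →L[ℝ]
      (MatTuple m (fun _ => r) × MatTuple n (fun _ => r)) →L[ℝ] MatTuple m n :=
  LinearMap.toContinuousBilinearMap (LinearMap.mk₂ ℝ (fun x y => loraProd x.1 y.2)
    (fun x y z => by funext l; simp [loraProd, Matrix.add_mul])
    (fun c x y => by funext l; simp [loraProd])
    (fun x y z => by funext l; simp [loraProd, Matrix.mul_add])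
    (fun c x y => by funext l; simp [loraProd]))

theorem loraBilin_apply {r : ℕ} (x y : MatTuple m (fun _ => r) × MatTuple n (fun _ => r)) :
    loraBilin m n r x y = loraProd x.1 y.2 := rfl

/-- The bilinear form whose quadratic form is the weight decay term. -/
noncomputable def decayBilin (m n : Fin L → ℕ) (r : ℕ) (lam : ℝ) :
    (MatTuple m (fun _ => r) × MatTuple n (fun _ => r)) →L[ℝ]
      (MatTuple m (fun _ => r) × MatTuple n (fun _ => r)) →L[ℝ] ℝ :=
  LinearMap.toContinuousBilinearMap (LinearMap.mk₂ ℝ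
    (fun x y => lam / 2 * ∑ l, (matInner (x.1 l) (y.1 l) + matInner (x.2 l) (y.2 l)))
    (fun x y z => by
      simp only [Prod.fst_add, Prod.snd_add, Pi.add_apply, matInner_add_left,
        Finset.sum_add_distrib]
      ring)
    (fun c x y => by
      simp only [Prod.smul_fst, Prod.smul_snd, Pi.smul_apply, matInner_smul_left, ← mul_add,
        ← Finset.mul_sum, smul_eq_mul]
      ring)
    (fun x y z => by
      simp only [Prod.fst_add, Prod.snd_add, Pi.add_apply, matInner_add_right,
        Finset.sum_add_distrib]
      ring)
    (fun c x y => by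
      simp only [Prod.smul_fst, Prod.smul_snd, Pi.smul_apply, matInner_smul_right, ← mul_add,
        ← Finset.mul_sum, smul_eq_mul]
      ring))

theorem decayBilin_apply {r : ℕ} (lam : ℝ)
    (x y : MatTuple m (fun _ => r) × MatTuple n (fun _ => r)) :
    decayBilin m n r lam x y =
      lam / 2 * ∑ l, (matInner (x.1 l) (y.1 l) + matInner (x.2 l) (y.2 l)) := rfl

theorem loraLoss_eq (f : MatTuple m n → ℝ) (lam : ℝ) (r : ℕ) :
    loraLoss f lam r = fun x => f (loraBilin m n r x x) + decayBilin m n r lam x x := by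
  funext x
  rw [loraLoss, loraBilin_apply, decayBilin_apply, tupleFrobNorm_sq, tupleFrobNorm_sq,
    ← Finset.sum_add_distrib]
  simp only [norm_sq_eq_matInner]

theorem sum_matInner_single {m n : Fin L → ℕ} (l : Fin L) (A : MatTuple m n)
    (U : Matrix (Fin (m l)) (Fin (n l)) ℝ) :
    ∑ k, matInner (A k) ((Pi.single l U : MatTuple m n) k) = matInner (A l) U := by
  rw [Finset.sum_eq_single l]
  · rw [Pi.single_eq_same]
  · intro k _ hk
    rw [Pi.single_eq_of_ne hk]; simp [matInner]
  · simp

/-- The first and second order conditions for variations of the `l`-th block. -/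
theorem IsSOSP.lora {f : MatTuple m n → ℝ} (hf : TwiceDifferentiable f) {lam : ℝ} {r : ℕ}
    {A : MatTuple m (fun _ => r)} {B : MatTuple n (fun _ => r)}
    (h : IsSOSP (loraLoss f lam r) (A, B)) (l : Fin L)
    (U : Matrix (Fin (m l)) (Fin r) ℝ) (V : Matrix (Fin (n l)) (Fin r) ℝ) :
    matInner (partialGrad f (loraProd A B) l) (A l * Vᵀ + U * (B l)ᵀ) +
      lam * (matInner (A l) U + matInner (B l) V) = 0 ∧
    0 ≤ partialHess f (loraProd A B) l (A l * Vᵀ + U * (B l)ᵀ) +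
      2 * matInner (partialGrad f (loraProd A B) l) (U * Vᵀ) + lam * (‖U‖ ^ 2 + ‖V‖ ^ 2) := by
  rw [loraLoss_eq] at h
  have e1 : ∀ (A : MatTuple m (fun _ => r)),
      loraProd A (Pi.single l V : MatTuple n (fun _ => r)) = Pi.single l (A l * Vᵀ) := by
    intro A
    funext k
    rcases eq_or_ne k l with rfl | hk
    · simp [loraProd]
    · simp [loraProd, Pi.single_eq_of_ne hk]
  have e2 : loraProd (Pi.single l U : MatTuple m (fun _ => r)) B = Pi.single l (U * (B l)ᵀ) := by
    funext k
    rcases eq_or_ne k l with rfl | hk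
    · simp [loraProd]
    · simp [loraProd, Pi.single_eq_of_ne hk]
  have e4 : loraProd (Pi.single l U : MatTuple m (fun _ => r)) (Pi.single l V) =
      Pi.single l (U * Vᵀ) := by rw [e1, Pi.single_eq_same]
  have key : fderiv ℝ f (loraProd A B) (loraProd A (Pi.single l V) + loraProd (Pi.single l U) B) +
      (lam / 2 * ∑ k, (matInner (A k) ((Pi.single l U : MatTuple m (fun _ => r)) k) +
        matInner (B k) ((Pi.single l V : MatTuple n (fun _ => r)) k)) +
       lam / 2 * ∑ k, (matInner ((Pi.single l U : MatTuple m (fun _ => r)) k) (A k) +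
        matInner ((Pi.single l V : MatTuple n (fun _ => r)) k) (B k))) = 0 ∧
      0 ≤ fderiv ℝ (fderiv ℝ f) (loraProd A B)
          (loraProd A (Pi.single l V) + loraProd (Pi.single l U) B)
          (loraProd A (Pi.single l V) + loraProd (Pi.single l U) B) +
        2 * fderiv ℝ f (loraProd A B) (loraProd (Pi.single l U) (Pi.single l V)) +
        2 * (lam / 2 * ∑ k, (matInner ((Pi.single l U : MatTuple m (fun _ => r)) k)
            ((Pi.single l U : MatTuple m (fun _ => r)) k) +
          matInner ((Pi.single l V : MatTuple n (fun _ => r)) k)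
            ((Pi.single l V : MatTuple n (fun _ => r)) k))) :=
    h.of_bilinear hf (loraBilin m n r) (decayBilin m n r lam) (Pi.single l U, Pi.single l V)
  simp only [e4, e1, e2, Pi.single_eq_same, ← Pi.single_add,
    fderiv_single_eq_matInner, Finset.sum_add_distrib, sum_matInner_single] at key
  have s1 : ∑ k, matInner ((Pi.single l U : MatTuple m (fun _ => r)) k) (A k) =
      matInner (A l) U := by
    rw [← sum_matInner_single l A U]
    exact Finset.sum_congr rfl fun _ _ => matInner_comm _ _
  have s2 : ∑ k, matInner ((Pi.single l V : MatTuple n (fun _ => r)) k) (B k) =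
      matInner (B l) V := by
    rw [← sum_matInner_single l B V]
    exact Finset.sum_congr rfl fun _ _ => matInner_comm _ _
  rw [s1, s2] at key
  refine ⟨by linarith [key.1], ?_⟩
  have h2 := key.2
  rw [← norm_sq_eq_matInner, ← norm_sq_eq_matInner] at h2
  have e3 : partialHess f (loraProd A B) l (A l * Vᵀ + U * (B l)ᵀ) =
    fderiv ℝ (fderiv ℝ f) (loraProd A B) (Pi.single l (A l * Vᵀ + U * (B l)ᵀ))
      (Pi.single l (A l * Vᵀ + U * (B l)ᵀ)) := rfl
  rw [e3]
  linarith

theorem eq_zero_of_forall_matInner_eq_zero {p q : ℕ} {M : Matrix (Fin p) (Fin q) ℝ}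
    (h : ∀ U, matInner M U = 0) : M = 0 := by
  have := h M
  rw [← norm_sq_eq_matInner] at this
  simpa using this

theorem matInner_mul_transpose_right {p q r : ℕ} (G : Matrix (Fin p) (Fin q) ℝ)
    (U : Matrix (Fin p) (Fin r) ℝ) (B : Matrix (Fin q) (Fin r) ℝ) :
    matInner G (U * Bᵀ) = matInner (G * B) U := by
  rw [matInner, matInner, transpose_mul, ← Matrix.mul_assoc, trace_mul_comm, Matrix.mul_assoc]

/-- Only `A` is varied: the first-order condition with `V = 0` pairs `G B + λ A` with an arbitrary
`U`. -/
theorem IsSOSP.lora_grad_left {f : MatTuple m n → ℝ} (hf : TwiceDifferentiable f) {lam : ℝ}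
    {r : ℕ} {A : MatTuple m (fun _ => r)} {B : MatTuple n (fun _ => r)}
    (h : IsSOSP (loraLoss f lam r) (A, B)) (l : Fin L) :
    partialGrad f (loraProd A B) l * B l = -(lam • A l) := by
  rw [← add_eq_zero_iff_eq_neg]
  refine eq_zero_of_forall_matInner_eq_zero fun U => ?_
  have := (h.lora hf l U 0).1
  rw [matInner_add_left, matInner_smul_left, ← this]
  rw [transpose_zero, Matrix.mul_zero, zero_add, matInner_mul_transpose_right]
  simp [matInner]

theorem IsSOSP.lora_grad_right {f : MatTuple m n → ℝ} (hf : TwiceDifferentiable f) {lam : ℝ}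
    {r : ℕ} {A : MatTuple m (fun _ => r)} {B : MatTuple n (fun _ => r)}
    (h : IsSOSP (loraLoss f lam r) (A, B)) (l : Fin L) :
    (partialGrad f (loraProd A B) l)ᵀ * A l = -(lam • B l) := by
  rw [← add_eq_zero_iff_eq_neg]
  refine eq_zero_of_forall_matInner_eq_zero fun V => ?_
  have := (h.lora hf l 0 V).1
  rw [Matrix.zero_mul, add_zero, matInner_mul_right, ← matInner_transpose, transpose_mul,
    transpose_transpose, transpose_transpose] at this
  rw [matInner_add_left, matInner_smul_left, ← this]
  simp [matInner]

end Lora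

/-! ### The subgradient condition at the global minimizer. -/

section Optimality

variable {L : ℕ} {m n : Fin L → ℕ}

/-- First order optimality of a global minimizer of the regularized full loss. -/
theorem IsGlobalMin.matInner_partialGrad_le {f : MatTuple m n → ℝ} (hf : TwiceDifferentiable f)
    {lam : ℝ} (hlam : 0 ≤ lam) {X : MatTuple m n} (h : IsGlobalMin (fullLoss f lam) X)
    (l : Fin L) (Y : Matrix (Fin (m l)) (Fin (n l)) ℝ) :
    -matInner (partialGrad f X l) (Y - X l) ≤ lam * (nuclearNorm Y - nuclearNorm (X l)) := by
  set W : MatTuple m n := Pi.single l (Y - X l) with hW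
  have hd : HasDerivAt (fun t : ℝ => f (X + t • W)) (fderiv ℝ f X W) 0  :=
    hasDerivAt_comp_add_smul hf.1 X W
  rw [hW, fderiv_single_eq_matInner, ← hW] at hd
  have hs := (hasDerivWithinAt_iff_tendsto_slope' (s := Set.Ioi (0 : ℝ)) (by simp)).1
    hd.hasDerivWithinAt
  -- Along the segment towards `Y` the nuclear norm lies below its chord, so minimality bounds the
  -- slope of `f` from below; `f` itself need not be convex.
  have hlow : ∀ᶠ t in nhdsWithin (0 : ℝ) (Set.Ioi 0),
      -(lam * (nuclearNorm Y - nuclearNorm (X l))) ≤ slope (fun t : ℝ => f (X + t • W)) 0 t := by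
    have : Set.Ioo (0 : ℝ) 1 ∈ nhdsWithin (0 : ℝ) (Set.Ioi 0) :=
      Ioo_mem_nhdsGT (by norm_num)
    filter_upwards [this] with t ht
    rw [slope_def_field, zero_smul, add_zero, sub_zero, le_div_iff₀ ht.1]
    have h1 := h (X + t • W)
    simp only [fullLoss] at h1
    have h2 : tupleNuclearNorm (X + t • W) ≤
        tupleNuclearNorm X + t * (nuclearNorm Y - nuclearNorm (X l)) := by
      rw [tupleNuclearNorm, tupleNuclearNorm, ← Finset.add_sum_erase _ _ (Finset.mem_univ l),
        ← Finset.add_sum_erase _ _ (Finset.mem_univ l)]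
      have e1 : ∑ k ∈ Finset.univ.erase l, nuclearNorm ((X + t • W) k) =
          ∑ k ∈ Finset.univ.erase l, nuclearNorm (X k) := by
        refine Finset.sum_congr rfl fun k hk => ?_
        rw [Pi.add_apply, Pi.smul_apply, hW, Pi.single_eq_of_ne (Finset.ne_of_mem_erase hk),
          smul_zero, add_zero]
      have e2 : (X + t • W) l = X l + t • (Y - X l) := by
        rw [Pi.add_apply, Pi.smul_apply, hW, Pi.single_eq_same]
      rw [e1, e2]
      linarith [nuclearNorm_convex (X l) Y ht.1.le ht.2.le]
    nlinarith [mul_le_mul_of_nonneg_left h2 hlam]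
  have := ge_of_tendsto hs hlow
  linarith

end Optimality

/-! ### Balanced factors, singular vectors and second-order conditions. -/

section Factorization

variable {p q r : ℕ}

theorem IsThinSVD.transpose {X : Matrix (Fin p) (Fin q) ℝ} {P : Matrix (Fin p) (Fin r) ℝ}
    {s : Fin r → ℝ} {Q : Matrix (Fin q) (Fin r) ℝ} (h : IsThinSVD X P s Q) :
    IsThinSVD Xᵀ Q s P :=
  ⟨h.right, h.left, by
    rw [h.eq, transpose_mul, transpose_mul, transpose_transpose, diagonal_transpose,
      Matrix.mul_assoc], h.pos, h.anti⟩

theorem IsThinSVD.mulVec_col {X : Matrix (Fin p) (Fin q) ℝ} {P : Matrix (Fin p) (Fin r) ℝ}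
    {s : Fin r → ℝ} {Q : Matrix (Fin q) (Fin r) ℝ} (h : IsThinSVD X P s Q) (i : Fin r) :
    X *ᵥ (fun a => Q a i) = s i • (fun a => P a i) := by
  have h1 : X * Q = P * diagonal s := by
    rw [h.eq, Matrix.mul_assoc, h.right, Matrix.mul_one]
  ext a
  have h2 := congrFun (congrFun h1 a) i
  rw [mul_diagonal] at h2
  rw [Pi.smul_apply, smul_eq_mul, mul_comm, ← h2]
  rfl

/-- If both factors were injective, `AᵀA BᵀB = Aᵀ (A Bᵀ) B` would be invertible, forcing `A Bᵀ` to
have rank at least `r`. -/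
theorem exists_ne_zero_mulVec_eq_zero {A : Matrix (Fin p) (Fin r) ℝ}
    {B : Matrix (Fin q) (Fin r) ℝ} (h : (A * Bᵀ).rank < r) :
    ∃ w : Fin r → ℝ, w ≠ 0 ∧ (A *ᵥ w = 0 ∨ B *ᵥ w = 0) := by
  by_contra! hc
  have inj : ∀ {k : ℕ} (C : Matrix (Fin k) (Fin r) ℝ), (∀ w, w ≠ 0 → C *ᵥ w ≠ 0) →
      IsUnit (Cᵀ * C) := by
    intro k C hC
    rw [← mulVec_injective_iff_isUnit]
    refine (injective_iff_map_eq_zero (mulVecLin (Cᵀ * C))).2 fun w hw => ?_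
    by_contra hw0
    refine hC w hw0 ?_
    rw [mulVecLin_apply, ← mulVec_mulVec] at hw
    have : C *ᵥ w ⬝ᵥ C *ᵥ w = 0 := by
      rw [dotProduct_mulVec_transpose, hw, zero_dotProduct]
    exact dotProduct_self_eq_zero.1 this
  have hu := (inj A fun w hw => (hc w hw).1).mul (inj B fun w hw => (hc w hw).2)
  have h1 := rank_of_isUnit _ hu
  have h2 : Aᵀ * A * (Bᵀ * B) = Aᵀ * (A * Bᵀ) * B := by simp only [Matrix.mul_assoc]
  rw [h2, Fintype.card_fin] at h1
  have h3 := (rank_mul_le_left (Aᵀ * (A * Bᵀ)) B).trans (rank_mul_le_right Aᵀ (A * Bᵀ))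
  omega

theorem eq_zero_of_forall_nonneg_add_mul {c k : ℝ} (h : ∀ t : ℝ, 0 ≤ c + t * k) : k = 0 := by
  by_contra hk
  have := h (-(c + 1) / k)
  rw [div_mul_cancel₀ _ hk] at this
  linarith

variable {G : Matrix (Fin p) (Fin q) ℝ} {A : Matrix (Fin p) (Fin r) ℝ}
  {B : Matrix (Fin q) (Fin r) ℝ} {lam : ℝ}

/-- The factors of a stationary point of the regularized factorized problem are balanced. -/
theorem transpose_mul_self_eq (hl : lam ≠ 0) (hGB : G * B = -(lam • A))
    (hGA : Gᵀ * A = -(lam • B)) : Aᵀ * A = Bᵀ * B := by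
  have h1 : Aᵀ * (G * B) = (Gᵀ * A)ᵀ * B := by
    rw [transpose_mul, transpose_transpose, Matrix.mul_assoc]
  rw [hGB, hGA] at h1
  simpa [hl] using h1

/-- At a rank deficient second-order stationary point the gradient is bounded by `λ`. -/
theorem opBound_neg_of_rank_lt {hess : Matrix (Fin p) (Fin q) ℝ → ℝ} (hess0 : hess 0 = 0)
    (hlam : 0 ≤ lam) (hGB : G * B = -(lam • A)) (hGA : Gᵀ * A = -(lam • B))
    (hsec : ∀ (U : Matrix (Fin p) (Fin r) ℝ) (V : Matrix (Fin q) (Fin r) ℝ),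
      0 ≤ hess (A * Vᵀ + U * Bᵀ) + 2 * matInner G (U * Vᵀ) + lam * (‖U‖ ^ 2 + ‖V‖ ^ 2))
    (hrank : (A * Bᵀ).rank < r) : OpBound (-G) lam := by
  obtain ⟨w, hw, hAB⟩ := exists_ne_zero_mulVec_eq_zero hrank
  have hww : 0 < w ⬝ᵥ w := by
    refine lt_of_le_of_ne (dotProduct_self_star_nonneg w) fun h => hw ?_
    exact dotProduct_self_eq_zero.1 h.symm
  intro u v
  -- The perturbations `t u wᵀ` of `A` and `t' v wᵀ` of `B` use the spare direction `w`.
  have hsec' : ∀ t t' : ℝ, 0 ≤ hess (t' • vecMulVec (A *ᵥ w) v + t • vecMulVec u (B *ᵥ w)) +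
      2 * (t * t' * (w ⬝ᵥ w) * (u ⬝ᵥ G *ᵥ v)) +
      lam * (t ^ 2 * ((u ⬝ᵥ u) * (w ⬝ᵥ w)) + t' ^ 2 * ((v ⬝ᵥ v) * (w ⬝ᵥ w))) := by
    intro t t'
    have := hsec (t • vecMulVec u w) (t' • vecMulVec v w)
    rw [norm_smul, norm_smul, mul_pow, mul_pow, norm_vecMulVec_sq, norm_vecMulVec_sq,
      Real.norm_eq_abs, Real.norm_eq_abs, sq_abs, sq_abs, transpose_smul, transpose_vecMulVec,
      Matrix.mul_smul, mul_vecMulVec, Matrix.smul_mul, Matrix.smul_mul, Matrix.mul_smul,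
      vecMulVec_mul, vecMul_transpose, matInner_smul_right, matInner_smul_right,
      vecMulVec_mul_vecMulVec, vecMulVec_smul, matInner_smul_right, matInner_vecMulVec] at this
    linarith
  have hz : vecMulVec u (0 : Fin q → ℝ) = 0 := by ext; simp [vecMulVec_apply]
  rw [neg_mulVec, dotProduct_neg]
  rcases hlam.eq_or_lt with hl | hl
  · subst hl
    -- Without weight decay the factors need not be balanced, so perhaps only one of them kills `w`.
    -- Scaling the perturbation of the other factor leaves the Hessian term fixed, and an affine
    -- function of `t` bounded below is constant.
    have hk : 2 * (w ⬝ᵥ w) * (u ⬝ᵥ G *ᵥ v) = 0 := by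
      rcases hAB with h | h
      · refine eq_zero_of_forall_nonneg_add_mul (c := hess (vecMulVec u (B *ᵥ w))) fun t => ?_
        have := hsec' 1 t
        rw [h] at this
        simp only [zero_vecMulVec, smul_zero, zero_add, one_smul] at this
        linarith
      · refine eq_zero_of_forall_nonneg_add_mul (c := hess (vecMulVec (A *ᵥ w) v)) fun t => ?_
        have := hsec' t 1
        rw [h] at this
        simp only [hz, smul_zero, add_zero, one_smul] at this
        linarith
    have : u ⬝ᵥ G *ᵥ v = 0 := by
      rcases mul_eq_zero.1 hk with h | h
      · linarith
      · exact h
    rw [this]; simp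
  -- Balancedness makes `w` vanish under both factors, so the Hessian term disappears.
  · have hbal := transpose_mul_self_eq hl.ne' hGB hGA
    have hnorm : A *ᵥ w ⬝ᵥ A *ᵥ w = B *ᵥ w ⬝ᵥ B *ᵥ w := by
      rw [dotProduct_mulVec_transpose, mulVec_mulVec, hbal, ← mulVec_mulVec,
        ← dotProduct_mulVec_transpose]
    have h0 : A *ᵥ w = 0 ∧ B *ᵥ w = 0 := by
      rcases hAB with h | h
      · refine ⟨h, dotProduct_self_eq_zero.1 ?_⟩
        rw [← hnorm, h, zero_dotProduct]
      · refine ⟨dotProduct_self_eq_zero.1 ?_, h⟩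
        rw [hnorm, h, zero_dotProduct]
    have := hsec' 1 1
    rw [h0.1, h0.2] at this
    simp only [zero_vecMulVec, hz, smul_zero, add_zero, hess0] at this
    have h2 : 0 ≤ (w ⬝ᵥ w) * (2 * (u ⬝ᵥ G *ᵥ v) + lam * (u ⬝ᵥ u + v ⬝ᵥ v)) := by linarith
    have := nonneg_of_mul_nonneg_right h2 hww
    linarith

/-- Uniqueness of positive square roots on an eigenvector: `(AAᵀ + s)(AAᵀ - s) v = 0`, and `AAᵀ + s`
is injective. -/
theorem mulVec_mulVec_transpose_eq_smul {v : Fin p → ℝ} {s : ℝ} (hs : 0 < s)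
    (h : A *ᵥ (Aᵀ *ᵥ (A *ᵥ (Aᵀ *ᵥ v))) = s ^ 2 • v) : A *ᵥ (Aᵀ *ᵥ v) = s • v := by
  set y := A *ᵥ (Aᵀ *ᵥ v) - s • v with hy
  have h1 : A *ᵥ (Aᵀ *ᵥ y) + s • y = 0 := by
    rw [hy, mulVec_sub, mulVec_sub, h, mulVec_smul, mulVec_smul, smul_sub, smul_smul, sq]
    abel
  have h2 : Aᵀ *ᵥ y ⬝ᵥ Aᵀ *ᵥ y + s * (y ⬝ᵥ y) = 0 := by
    have := congrArg (fun z => y ⬝ᵥ z) h1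
    simpa [dotProduct_add, dotProduct_smul, dotProduct_mulVec_transpose A, -mulVec_mulVec] using this
  have n1 : 0 ≤ Aᵀ *ᵥ y ⬝ᵥ Aᵀ *ᵥ y := dotProduct_self_star_nonneg _
  have n2 : 0 ≤ y ⬝ᵥ y := dotProduct_self_star_nonneg _
  have h3 : y ⬝ᵥ y = 0 := by
    have := mul_nonneg hs.le n2
    have h4 : s * (y ⬝ᵥ y) = 0 := by linarith
    exact (mul_eq_zero.1 h4).resolve_left hs.ne'
  have := dotProduct_self_eq_zero.1 h3
  rwa [hy, sub_eq_zero] at this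

/-- By balancedness `X Xᵀ = A (BᵀB) Aᵀ = (AAᵀ)²`. The factor `lam` on both sides makes the
unbalanced case `lam = 0` trivial. -/
theorem IsThinSVD.smul_mulVec_mulVec_transpose {P : Matrix (Fin p) (Fin r) ℝ}
    {s : Fin r → ℝ} {Q : Matrix (Fin q) (Fin r) ℝ} (h : IsThinSVD (A * Bᵀ) P s Q)
    (hGB : G * B = -(lam • A)) (hGA : Gᵀ * A = -(lam • B)) (i : Fin r) :
    lam • A *ᵥ (Aᵀ *ᵥ fun a => P a i) = (lam * s i) • fun a => P a i := by
  by_cases hl : lam = 0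
  · simp [hl]
  have hbal := transpose_mul_self_eq hl hGB hGA
  rw [mul_smul]
  congr 1
  refine mulVec_mulVec_transpose_eq_smul (h.pos i) ?_
  have h1 := h.mulVec_col i
  have h2 := h.transpose.mulVec_col i
  rw [transpose_mul, transpose_transpose, ← mulVec_mulVec] at h2
  rw [← mulVec_mulVec] at h1
  rw [mulVec_mulVec _ Aᵀ A, hbal, ← mulVec_mulVec, h2, mulVec_smul, mulVec_smul, h1, smul_smul, sq]

/-- For the `i`-th singular pair, `s_i G q_i = G B Aᵀ p_i = -λ A Aᵀ p_i = -λ s_i p_i`. -/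
theorem IsThinSVD.grad_mul {P : Matrix (Fin p) (Fin r) ℝ}
    {s : Fin r → ℝ} {Q : Matrix (Fin q) (Fin r) ℝ} (h : IsThinSVD (A * Bᵀ) P s Q)
    (hGB : G * B = -(lam • A)) (hGA : Gᵀ * A = -(lam • B)) : G * Q = -(lam • P) := by
  ext a i
  have h1 := h.smul_mulVec_mulVec_transpose hGB hGA i
  have h2 := h.transpose.mulVec_col i
  rw [transpose_mul, transpose_transpose, ← mulVec_mulVec] at h2
  have h3 : G *ᵥ (B *ᵥ (Aᵀ *ᵥ fun a => P a i)) = G *ᵥ (s i • fun a => Q a i) :=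
    congrArg (fun z => G *ᵥ z) h2
  rw [mulVec_mulVec, hGB, neg_mulVec, smul_mulVec, h1, mulVec_smul, mul_comm, mul_smul,
    ← smul_neg] at h3
  have h4 := congrFun (smul_right_injective _ (h.pos i).ne' h3) a
  exact h4.symm

theorem IsThinSVD.mul_dotProduct_transpose_mulVec {P : Matrix (Fin p) (Fin r) ℝ}
    {s : Fin r → ℝ} {Q : Matrix (Fin q) (Fin r) ℝ} (h : IsThinSVD (A * Bᵀ) P s Q)
    (hGB : G * B = -(lam • A)) (hGA : Gᵀ * A = -(lam • B)) (i : Fin r) :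
    lam * ((Aᵀ *ᵥ fun a => P a i) ⬝ᵥ (Aᵀ *ᵥ fun a => P a i)) = lam * s i := by
  have h1 := congrArg (fun z => (fun a => P a i) ⬝ᵥ z) (h.smul_mulVec_mulVec_transpose hGB hGA i)
  simpa [-mulVec_mulVec, dotProduct_smul, dotProduct_mulVec_transpose A,
    col_dotProduct_self h.left] using h1

theorem rank_vecMulVec_eq_one {u : Fin p → ℝ} {v : Fin q → ℝ} (h : ‖vecMulVec u v‖ = 1) :
    (vecMulVec u v).rank = 1 := by
  refine le_antisymm (rank_vecMulVec_le u v) (Nat.one_le_iff_ne_zero.2 fun h0 => ?_)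
  have h1 : vecMulVec u v = 0 := by
    rw [rank, Submodule.finrank_eq_zero, LinearMap.range_eq_bot] at h0
    exact ext_of_mulVec_single fun i => by
      rw [zero_mulVec]; exact congrArg (fun T => T (Pi.single i 1)) h0
  rw [h1, norm_zero] at h
  exact one_ne_zero h.symm

theorem norm_vecMulVec_eq_one {u : Fin p → ℝ} {v : Fin q → ℝ} (hu : u ⬝ᵥ u = 1)
    (hv : v ⬝ᵥ v = 1) : ‖vecMulVec u v‖ = 1 := by
  have := norm_vecMulVec_sq u v
  rw [hu, hv, one_mul] at this
  exact (pow_eq_one_iff_of_nonneg (norm_nonneg _) two_ne_zero).1 this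

/-- A bound for a bilinear form on unit vectors extends to all vectors. -/
theorem neg_two_mul_le_of_unit {C : ℝ} (hC : 0 ≤ C) {S : Submodule ℝ (Fin p → ℝ)}
    {T : Submodule ℝ (Fin q → ℝ)}
    (h : ∀ u ∈ S, ∀ v ∈ T, u ⬝ᵥ u = 1 → v ⬝ᵥ v = 1 → -(u ⬝ᵥ G *ᵥ v) ≤ C)
    {u : Fin p → ℝ} (hu : u ∈ S) {v : Fin q → ℝ} (hv : v ∈ T) :
    -2 * (u ⬝ᵥ G *ᵥ v) ≤ C * (u ⬝ᵥ u + v ⬝ᵥ v) := by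
  have n1 : 0 ≤ u ⬝ᵥ u := dotProduct_self_star_nonneg _
  have n2 : 0 ≤ v ⬝ᵥ v := dotProduct_self_star_nonneg _
  rcases n1.eq_or_lt with h1 | h1
  · rw [dotProduct_self_eq_zero.1 h1.symm]
    simp only [zero_dotProduct, mul_zero]
    positivity
  rcases n2.eq_or_lt with h2 | h2
  · rw [dotProduct_self_eq_zero.1 h2.symm]
    simp only [mulVec_zero, dotProduct_zero, mul_zero]
    positivity
  set a := Real.sqrt (u ⬝ᵥ u) with ha
  set b := Real.sqrt (v ⬝ᵥ v) with hb
  have ha0 : 0 < a := Real.sqrt_pos.2 h1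
  have hb0 : 0 < b := Real.sqrt_pos.2 h2
  have ha2 : u ⬝ᵥ u = a * a := (Real.mul_self_sqrt n1).symm
  have hb2 : v ⬝ᵥ v = b * b := (Real.mul_self_sqrt n2).symm
  have := h (a⁻¹ • u) (S.smul_mem _ hu) (b⁻¹ • v) (T.smul_mem _ hv)
    (by rw [smul_dotProduct, dotProduct_smul, ha2, smul_eq_mul, smul_eq_mul]; field_simp)
    (by rw [smul_dotProduct, dotProduct_smul, hb2, smul_eq_mul, smul_eq_mul]; field_simp)
  rw [mulVec_smul, smul_dotProduct, dotProduct_smul, smul_eq_mul, smul_eq_mul] at this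
  have h3 := mul_le_mul_of_nonneg_left this (mul_pos ha0 hb0).le
  have h4 : a * b * -(a⁻¹ * (b⁻¹ * (u ⬝ᵥ G *ᵥ v))) = -(u ⬝ᵥ G *ᵥ v) := by field_simp
  rw [h4] at h3
  rw [ha2, hb2]
  -- Rescaling gives `C a b`; then `2ab ≤ a² + b²`.
  nlinarith [mul_nonneg hC (sq_nonneg (a - b))]

/-- At a second-order stationary point of full rank, the gradient on the orthogonal complement of
the singular vectors is controlled by the smoothness constant. -/
theorem IsThinSVD.neg_two_mul_grad_le {hess : Matrix (Fin p) (Fin q) ℝ → ℝ}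
    {P : Matrix (Fin p) (Fin r) ℝ} {s : Fin r → ℝ} {Q : Matrix (Fin q) (Fin r) ℝ}
    (h : IsThinSVD (A * Bᵀ) P s Q) (hlam : 0 ≤ lam)
    (hGB : G * B = -(lam • A)) (hGA : Gᵀ * A = -(lam • B))
    (hsec : ∀ (U : Matrix (Fin p) (Fin r) ℝ) (V : Matrix (Fin q) (Fin r) ℝ),
      0 ≤ hess (A * Vᵀ + U * Bᵀ) + 2 * matInner G (U * Vᵀ) + lam * (‖U‖ ^ 2 + ‖V‖ ^ 2))
    {β : ℝ} (hβ : ∀ (U : Matrix (Fin p) (Fin p) ℝ) (V : Matrix (Fin q) (Fin q) ℝ),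
      U.rank = 1 → ‖U‖ = 1 → V.rank = 1 → ‖V‖ = 1 →
      hess (U * (A * Bᵀ) + (A * Bᵀ) * V) ≤ β * ‖U * (A * Bᵀ) + (A * Bᵀ) * V‖ ^ 2)
    (i : Fin r) {u : Fin p → ℝ} (hu : Pᵀ *ᵥ u = 0) {v : Fin q → ℝ} (hv : Qᵀ *ᵥ v = 0) :
    -2 * (u ⬝ᵥ G *ᵥ v) ≤ (lam + max (β * s i) 0) * (u ⬝ᵥ u + v ⬝ᵥ v) := by
  refine neg_two_mul_le_of_unit (S := LinearMap.ker (mulVecLin Pᵀ))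
    (T := LinearMap.ker (mulVecLin Qᵀ)) (by positivity) ?_ hu hv
  intro u hu v hv hu1 hv1
  have hpu : (fun a => P a i) ⬝ᵥ u = 0 := congrFun hu i
  have hqv : (fun a => Q a i) ⬝ᵥ v = 0 := congrFun hv i
  set x : Fin p → ℝ := fun a => P a i with hx
  set y : Fin q → ℝ := fun a => Q a i with hy
  have hXy : A *ᵥ (Bᵀ *ᵥ y) = s i • x := by rw [mulVec_mulVec]; exact h.mulVec_col i
  have hXx : B *ᵥ (Aᵀ *ᵥ x) = s i • y := by
    have := h.transpose.mulVec_col i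
    rwa [transpose_mul, transpose_transpose, ← mulVec_mulVec] at this
  have hxx : x ⬝ᵥ x = 1 := col_dotProduct_self h.left i
  have hyy : y ⬝ᵥ y = 1 := col_dotProduct_self h.right i
  have hs := h.pos i
  have hU := norm_vecMulVec_eq_one hu1 hxx
  have hV := norm_vecMulVec_eq_one hyy hv1
  -- Smoothness is tested on `(u xᵀ) X + X (y vᵀ) = s_i (u yᵀ + x vᵀ)`, which has squared norm `2
  -- s_i²` since `u ⊥ x`.
  have hb := hβ _ _ (rank_vecMulVec_eq_one hU) hU (rank_vecMulVec_eq_one hV) hV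
  have e1 : vecMulVec u x * (A * Bᵀ) + A * Bᵀ * vecMulVec y v =
      s i • (vecMulVec u y + vecMulVec x v) := by
    have : x ᵥ* (A * Bᵀ) = s i • y := by
      rw [← mulVec_transpose, transpose_mul, transpose_transpose, ← mulVec_mulVec, hXx]
    rw [vecMulVec_mul, mul_vecMulVec, this, ← mulVec_mulVec, hXy, vecMulVec_smul, smul_vecMulVec,
      smul_add]
  have hn : ‖s i • (vecMulVec u y + vecMulVec x v)‖ ^ 2 = s i ^ 2 * 2 := by
    rw [norm_smul, mul_pow, Real.norm_eq_abs, sq_abs, norm_sq_eq_matInner, matInner_add_left,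
      matInner_add_right, matInner_add_right, matInner_comm (vecMulVec x v) (vecMulVec u y),
      ← norm_sq_eq_matInner, ← norm_sq_eq_matInner, norm_vecMulVec_sq, norm_vecMulVec_sq,
      hu1, hv1, hxx, hyy, matInner_vecMulVec, vecMulVec_mulVec]
    simp [hpu]
    norm_num
  rw [e1, hn] at hb
  -- These factor perturbations produce the same matrix to first order, and `s_i u vᵀ` to second
  -- order.
  have h2 := hsec (vecMulVec u (Aᵀ *ᵥ x)) (vecMulVec v (Bᵀ *ᵥ y))
  have e2 : A * (vecMulVec v (Bᵀ *ᵥ y))ᵀ + vecMulVec u (Aᵀ *ᵥ x) * Bᵀ =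
      s i • (vecMulVec u y + vecMulVec x v) := by
    rw [transpose_vecMulVec, mul_vecMulVec, hXy, vecMulVec_mul, vecMul_transpose, hXx,
      vecMulVec_smul, smul_vecMulVec, smul_add, add_comm]
  have e3 : (Aᵀ *ᵥ x) ⬝ᵥ (Bᵀ *ᵥ y) = s i := by
    rw [← dotProduct_mulVec_transpose, hXy, dotProduct_smul, hxx, smul_eq_mul, mul_one]
  have e4 := h.mul_dotProduct_transpose_mulVec hGB hGA i
  have hT : IsThinSVD (B * Aᵀ) Q s P := by
    have := h.transpose
    rwa [transpose_mul, transpose_transpose] at this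
  have e5 := hT.mul_dotProduct_transpose_mulVec (G := Gᵀ) hGA
    (by rwa [transpose_transpose]) i
  rw [e2, transpose_vecMulVec, vecMulVec_mul_vecMulVec, e3, vecMulVec_smul, matInner_smul_right,
    matInner_vecMulVec, norm_vecMulVec_sq, norm_vecMulVec_sq, hu1, hv1, one_mul, one_mul,
    mul_add, e4, e5] at h2
  have h3 : 0 ≤ s i * (β * s i + u ⬝ᵥ G *ᵥ v + lam) := by linarith
  have h4 := nonneg_of_mul_nonneg_right h3 hs
  linarith [le_max_left (β * s i) 0]

end Factorization

/-! ### Ranks of tuples. -/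

section Tuple

variable {L : ℕ} {m n : Fin L → ℕ}

theorem rank_le_tupleRank (X : MatTuple m n) (l : Fin L) : (X l).rank ≤ tupleRank X :=
  Finset.le_sup (f := fun l => (X l).rank) (Finset.mem_univ l)

theorem tupleRank_loraProd_le {r : ℕ} (A : MatTuple m fun _ => r) (B : MatTuple n fun _ => r) :
    tupleRank (loraProd A B) ≤ r :=
  Finset.sup_le fun l _ =>
    (rank_mul_le_left _ _).trans (by simpa using (A l).rank_le_width)

end Tuple

/-! ### The dichotomy for a single block. -/

section Block

variable {p q r : ℕ} {G G' : Matrix (Fin p) (Fin q) ℝ} {A : Matrix (Fin p) (Fin r) ℝ}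
  {B : Matrix (Fin q) (Fin r) ℝ} {lam : ℝ}

/-- Stationarity gives `⟨G, A Bᵀ⟩ = -λ‖A‖² = -λ‖B‖²`; average the two and use `2‖A Bᵀ‖_* ≤ ‖A‖² +
‖B‖²`. -/
theorem matInner_add_nuclearNorm_le (hlam : 0 ≤ lam) (hGB : G * B = -(lam • A))
    (hGA : Gᵀ * A = -(lam • B)) :
    matInner G (A * Bᵀ) + lam * nuclearNorm (A * Bᵀ) ≤ 0 := by
  have h1 : matInner G (A * Bᵀ) = -(lam * ‖A‖ ^ 2) := by
    rw [matInner_mul_transpose_right, hGB, matInner_neg_left, matInner_smul_left,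
      norm_sq_eq_matInner]
  have h2 : matInner G (A * Bᵀ) = -(lam * ‖B‖ ^ 2) := by
    rw [← matInner_transpose, transpose_mul, transpose_transpose, matInner_mul_transpose_right,
      hGA, matInner_neg_left, matInner_smul_left, norm_sq_eq_matInner]
  have h3 := mul_le_mul_of_nonneg_left (nuclearNorm_mul_transpose_le A B) hlam
  linarith

/-- Strong convexity is played against near-optimality of `A Bᵀ` and optimality of `Y`: all nuclear
norms cancel and only the defect `c E` survives. -/
theorem mul_norm_sq_le_of_opBound {a c : ℝ} {Y E : Matrix (Fin p) (Fin q) ℝ} (hlam : 0 ≤ lam)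
    (hGB : G * B = -(lam • A)) (hGA : Gᵀ * A = -(lam • B))
    (hconv : a * ‖A * Bᵀ - Y‖ ^ 2 ≤ matInner (G - G') (A * Bᵀ - Y))
    (hopt : -matInner G' (A * Bᵀ - Y) ≤ lam * (nuclearNorm (A * Bᵀ) - nuclearNorm Y))
    (hE : OpBound (-G - c • E) lam) : a * ‖A * Bᵀ - Y‖ ^ 2 ≤ c * matInner E Y := by
  have h1 := matInner_add_nuclearNorm_le hlam hGB hGA
  have h2 := hE.matInner_le Y
  rw [matInner_sub_left, matInner_neg_left, matInner_smul_left] at h2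
  rw [matInner_sub_left, matInner_sub_right] at hconv
  linarith

/-- The dichotomy for a single block: a second-order stationary point either agrees with the
minimizer, or has full rank and is far from it. -/
theorem eq_or_full_rank_and_far {hess : Matrix (Fin p) (Fin q) ℝ → ℝ} (hess0 : hess 0 = 0)
    (hlam : 0 ≤ lam) (hGB : G * B = -(lam • A)) (hGA : Gᵀ * A = -(lam • B))
    (hsec : ∀ (U : Matrix (Fin p) (Fin r) ℝ) (V : Matrix (Fin q) (Fin r) ℝ),
      0 ≤ hess (A * Vᵀ + U * Bᵀ) + 2 * matInner G (U * Vᵀ) + lam * (‖U‖ ^ 2 + ‖V‖ ^ 2))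
    {α β : ℝ} (hα : 0 < α) (hβ : ∀ (U : Matrix (Fin p) (Fin p) ℝ) (V : Matrix (Fin q) (Fin q) ℝ),
      U.rank = 1 → ‖U‖ = 1 → V.rank = 1 → ‖V‖ = 1 →
      hess (U * (A * Bᵀ) + (A * Bᵀ) * V) ≤ β * ‖U * (A * Bᵀ) + (A * Bᵀ) * V‖ ^ 2)
    {Y : Matrix (Fin p) (Fin q) ℝ}
    (hconv : α * ‖A * Bᵀ - Y‖ ^ 2 ≤ matInner (G - G') (A * Bᵀ - Y))
    (hopt : -matInner G' (A * Bᵀ - Y) ≤ lam * (nuclearNorm (A * Bᵀ) - nuclearNorm Y))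
    {k : ℕ} (hY : Y.rank ≤ k) (hk : k ≤ r) {X : Matrix (Fin p) (Fin q) ℝ} (hX : X = A * Bᵀ) :
    X = Y ∨ 1 ≤ k ∧ X.rank = r ∧ 0 < β ∧ 0 < singVal X r ∧ singVal X r ≤ singVal X k ∧
      ∃ P, IsRankProjection k X P ∧ (k < r → 0 < ‖X - P‖ ^ 2) ∧
        β * singVal X r * ‖X - P‖ ^ 2 ≤
          (β * singVal X r - 2 * α * singVal X k) * ‖X - Y‖ ^ 2 := by
  rw [← hX] at hconv hopt hβ
  by_cases hXY : X = Y
  · exact Or.inl hXY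
  refine Or.inr ?_
  have hn : 0 < ‖X - Y‖ ^ 2 := by
    have := norm_pos_iff.2 (sub_ne_zero.2 hXY)
    positivity
  have hle : ∀ {c : ℝ} {E : Matrix (Fin p) (Fin q) ℝ}, OpBound (-G - c • E) lam →
      α * ‖X - Y‖ ^ 2 ≤ c * matInner E Y := by
    intro c E hE
    rw [hX] at hconv hopt ⊢
    exact mul_norm_sq_le_of_opBound hlam hGB hGA hconv hopt hE
  have hrle : X.rank ≤ r := by
    rw [hX]
    exact (rank_mul_le_left _ _).trans (by simpa using A.rank_le_width)
  have hr : X.rank = r := by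
    by_contra hne
    have := opBound_neg_of_rank_lt hess0 hlam hGB hGA hsec (by rw [← hX]; omega)
    -- In the rank-deficient case there is no defect, contradicting `X ≠ Y`.
    have := hle (c := 0) (E := 0) (by simpa using this)
    rw [zero_mul] at this
    nlinarith
  obtain ⟨P, Q, h⟩ := exists_isThinSVD X hr
  set s : Fin r → ℝ := fun i => (toEuclideanLin X).singularValues i with hs
  have h' := h
  rw [hX] at h'
  have hGQ := h'.grad_mul hGB hGA
  have hT : IsThinSVD (B * Aᵀ) Q s P := by
    have := h'.transpose
    rwa [transpose_mul, transpose_transpose] at this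
  have hGP := hT.grad_mul hGA (by rwa [transpose_transpose])
  -- For `k = 0` the minimizer block is zero, so the defect term `⟨E, Y⟩` vanishes whatever `E` is.
  have hk1 : 1 ≤ k := by
    by_contra hk0
    have hY0 : Y.rank = 0 := by omega
    have hY' : Y = 0 := by
      obtain ⟨P, Q, h⟩ := exists_isThinSVD Y hY0
      rw [h.eq]
      ext i j
      simp [mul_apply]
    rcases Nat.eq_zero_or_pos r with hr0 | hr0
    · obtain ⟨P, Q, h⟩ := exists_isThinSVD X (hr.trans hr0)
      refine hXY ?_
      rw [h.eq, hY']
      ext i j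
      simp [mul_apply]
    obtain ⟨E, -, -, -, hE⟩ := exists_opBound_split h.left h.right hlam (le_max_right _ 0) hGQ hGP
      fun u v hu hv => h'.neg_two_mul_grad_le hlam hGB hGA hsec (hX ▸ hβ) ⟨0, hr0⟩ hu hv
    have := hle hE
    rw [hY'] at this
    simp only [matInner, Matrix.mul_zero, trace_zero, mul_zero] at this
    rw [← hY'] at this
    nlinarith
  have hr1 : 1 ≤ r := hk1.trans hk
  let i : Fin r := ⟨r - 1, by omega⟩
  let j : Fin r := ⟨k - 1, by omega⟩
  have hsi : singVal X r = s i := rfl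
  have hsj : singVal X k = s j := rfl
  obtain ⟨E, hE1, hPE, hEQ, hE⟩ := exists_opBound_split h.left h.right hlam
    (le_max_right (β * s i) 0) hGQ hGP
    fun u v hu hv => h'.neg_two_mul_grad_le hlam hGB hGA hsec (hX ▸ hβ) i hu hv
  have hmain := hle hE
  have hαn : 0 < α * ‖X - Y‖ ^ 2 := by positivity
  -- A nonpositive `β σ_r` would again leave no defect.
  have hmax : 0 < β * s i := by
    by_contra hneg
    rw [max_eq_right (not_lt.1 hneg), zero_mul] at hmain
    linarith
  rw [max_eq_left hmax.le] at hmain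
  have hspos := h.pos i
  have hsposj := h.pos j
  obtain ⟨Z, hZ, hZn⟩ := h.exists_isRankProjection hk1 hk
  refine ⟨hk1, hr, pos_of_mul_pos_left hmax hspos.le, hspos,
    h.anti (Fin.mk_le_mk.2 (by omega) : j ≤ i), Z, hZ, fun hkr => ?_, ?_⟩
  · rw [hZn]
    refine Finset.sum_pos' (fun a _ => by split_ifs <;> positivity) ⟨i, Finset.mem_univ _, ?_⟩
    have : ¬ (i : ℕ) < k := by simp only [i]; omega
    rw [if_neg this]
    positivity
  · have hK := h.sum_add_le_norm_sub_sq hsposj.le hk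
      (fun a ha => h.anti (Fin.mk_le_mk.2 (by omega) : a ≤ j))
      (fun a ha => h.anti (Fin.mk_le_mk.2 (by omega) : j ≤ a)) hE1 hPE hEQ hY
    rw [← hZn] at hK
    rw [hsi, hsj]
    -- Eliminate `⟨E, Y⟩`: the approximation inequality times `β σ_r`, the convexity inequality
    -- times `σ_k`.
    have h1 := mul_le_mul_of_nonneg_left hK hmax.le
    have h2 := mul_le_mul_of_nonneg_left hmain hsposj.le
    linarith

end Block

end LoRA

/-! ### Assembly of the blocks and the two regimes. -/

theorem theorem2 {L : ℕ} (m n : Fin L → ℕ)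
    (f : LoRA.MatTuple m n → ℝ) (hf : LoRA.TwiceDifferentiable f)
    (lam : ℝ) (hlam : 0 ≤ lam)
    (Xs : LoRA.MatTuple m n) (hXs : LoRA.IsGlobalMin (LoRA.fullLoss f lam) Xs)
    (rs : ℕ) (hrs : LoRA.tupleRank Xs = rs)
    (r : ℕ) (hr : rs ≤ r) (D : ℝ)
    (α β : Fin L → ℝ) (hα : ∀ l, 0 < α l)
    (hRSC : LoRA.RestrictedStronglyConvex f α r D Xs)
    (hRSM : LoRA.RestrictedSmooth f β r D Xs)
    (A : LoRA.MatTuple m (fun _ => r)) (B : LoRA.MatTuple n (fun _ => r))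
    (hAB : LoRA.IsSOSP (LoRA.loraLoss f lam r) (A, B))
    (X : LoRA.MatTuple m n) (hX : X = LoRA.loraProd A B)
    (hD : LoRA.tupleFrobNorm (X - Xs) ≤ D) :
    -- special regime
    (((∀ l, β l ≤ 2 * α l) ∧ (r = rs → ∀ l, 2 * α l ≠ β l)) →
      LoRA.IsGlobalMin (LoRA.fullLoss f lam) X) ∧
    -- generic regime
    (((∃ l, 2 * α l < β l) ∨ (r = rs ∧ ∃ l, 2 * α l = β l)) →
      LoRA.IsGlobalMin (LoRA.fullLoss f lam) X ∨
      (¬ LoRA.IsGlobalMin (LoRA.fullLoss f lam) X ∧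
        ∃ l, 1 ≤ rs ∧ (X l).rank = r ∧
          ((2 * α l / β l * LoRA.singVal (X l) rs < LoRA.singVal (X l) r ∧
            ∃ P, LoRA.IsRankProjection rs (X l) P ∧
              ‖X l - P‖ ^ 2 /
                  (1 - 2 * α l * LoRA.singVal (X l) rs / (β l * LoRA.singVal (X l) r))
                ≤ ‖X l - Xs l‖ ^ 2) ∨
           -- boundary case, in which `σ_r = σ_{rs} = (2α/β) σ_{rs}` and `X l` is its own projection
           (r = rs ∧ 2 * α l = β l)))) := by 
  have hblock := fun l => LoRA.eq_or_full_rank_and_far (hess := LoRA.partialHess f X l)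
    (G := LoRA.partialGrad f X l) (G' := LoRA.partialGrad f Xs l) (A := A l) (B := B l)
    (k := rs) (X := X l) (Y := Xs l) (by simp [LoRA.partialHess]) hlam
    (by rw [hX]; exact hAB.lora_grad_left hf l) (by rw [hX]; exact hAB.lora_grad_right hf l)
    (fun U V => by rw [hX]; exact (hAB.lora hf l U V).2) (hα l)
    (by
      have := hRSM l X hD (hX ▸ LoRA.tupleRank_loraProd_le A B)
      rwa [show X l = A l * (B l).transpose by rw [hX]; rfl] at this)
    (by
      have := hRSC l X hD (hX ▸ LoRA.tupleRank_loraProd_le A B)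
      rwa [show X l = A l * (B l).transpose by rw [hX]; rfl] at this)
    (hXs.matInner_partialGrad_le hf hlam l _)
    (hrs ▸ LoRA.rank_le_tupleRank Xs l) hr (by rw [hX]; rfl)
  have hglob : LoRA.IsGlobalMin (LoRA.fullLoss f lam) X ∨ ∃ l, X l ≠ Xs l := by
    by_contra! h
    exact h.1 (funext h.2 ▸ hXs)
  have hne : ∀ l, X l ≠ Xs l → 1 ≤ rs ∧ (X l).rank = r ∧
      ((2 * α l / β l * LoRA.singVal (X l) rs < LoRA.singVal (X l) r ∧
        ∃ P, LoRA.IsRankProjection rs (X l) P ∧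
          ‖X l - P‖ ^ 2 / (1 - 2 * α l * LoRA.singVal (X l) rs / (β l * LoRA.singVal (X l) r))
            ≤ ‖X l - Xs l‖ ^ 2) ∨ (r = rs ∧ 2 * α l = β l)) ∧
      (β l ≤ 2 * α l → r = rs ∧ 2 * α l = β l) := by
    intro l hl
    obtain ⟨h1, h2, hβ, hσ, hσσ, P, hP, hPpos, hle⟩ := (hblock l).resolve_left hl
    have hn : 0 < ‖X l - Xs l‖ ^ 2 := by
      have := norm_pos_iff.2 (sub_ne_zero.2 hl)
      positivity
    set a := LoRA.singVal (X l) rs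
    set b := LoRA.singVal (X l) r with hb
    have hβb : 0 < β l * b := mul_pos hβ hσ
    have hP0 : 0 ≤ ‖X l - P‖ ^ 2 := by positivity
    -- For `rs < r` the distance to the projection is positive and the inequality is strict. For `r
    -- = rs` the two singular values coincide and equality can occur only if `2α = β`.
    have hcase : 2 * α l * a < β l * b ∨ (r = rs ∧ 2 * α l = β l) := by
      rcases hr.eq_or_lt with hrr | hrr
      · have hab : a = b := by simp only [a, b, hrr]
        have h3 : 0 ≤ β l * b - 2 * α l * a :=
          nonneg_of_mul_nonneg_left ((mul_nonneg hβb.le hP0).trans hle) hn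
        rw [hab] at h3 ⊢
        rcases h3.eq_or_lt with h4 | h4
        · refine Or.inr ⟨hrr.symm, mul_right_cancel₀ hσ.ne' (by linarith)⟩
        · exact Or.inl (by linarith)
      · have h3 := pos_of_mul_pos_left ((mul_pos hβb (hPpos hrr)).trans_le hle) hn.le
        exact Or.inl (by linarith)
    refine ⟨h1, h2, hcase.imp_left fun h => ⟨?_, P, hP, ?_⟩, fun hle2 => ?_⟩
    · rw [div_mul_eq_mul_div, div_lt_iff₀ hβ]
      linarith
    · have h4 : 1 - 2 * α l * a / (β l * b) = (β l * b - 2 * α l * a) / (β l * b) := by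
        field_simp
      rw [h4, div_div_eq_mul_div, div_le_iff₀ (by linarith)]
      linarith
    · refine hcase.resolve_left fun h => ?_
      -- `β ≤ 2α` and `σ_r ≤ σ_{rs}` exclude the strict alternative.
      have h5 : β l * b ≤ 2 * α l * a := mul_le_mul hle2 hσσ hσ.le (by linarith [hα l])
      linarith
  refine ⟨fun h => ?_, fun _ => ?_⟩
  · rcases hglob with hg | ⟨l, hl⟩
    · exact hg
    · obtain ⟨h1, h2⟩ := (hne l hl).2.2.2 (h.1 l)
      exact absurd h2 (h.2 h1 l)
  · by_cases hg : LoRA.IsGlobalMin (LoRA.fullLoss f lam) X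
    · exact Or.inl hg
    · obtain ⟨l, hl⟩ := hglob.resolve_left hg
      obtain ⟨h1, h2, h3, -⟩ := hne l hl
      exact Or.inr ⟨hg, l, h1, h2, h3⟩
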